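/- Let $N\ge 1$. For bounded measurable $\rho_1,\rho_2:\mathbb R^N\to[0,\infty)$ with bounded support and an integer $k\ge 0$, the $k$-th eigenvalue of the (possibly degenerate) problem $-\operatorname{div}(\rho_1\nabla u)=\mu\,\rho_2u$ with Neumann boundary conditions is $$\mu_k(\rho_1,\rho_2):=\inf_{S}\ \max_{u\in S\setminus\{0\}}\frac{\int_{\mathbb R^N}\rho_1|\nabla u|^2\,dx}{\int_{\mathbb R^N}\rho_2u^2\,dx},$$ where $S$ ranges over the $(k+1)$-dimensional subspaces of $\{u\cdot 1_{\{\rho_2>0\}}:u\in C_c^\infty(\mathbb R^N)\}$ (functions being identified when they agree almost everywhere). Put $\mu_k(\rho):=\mu_k(\rho,\rho)$. Let $D\subset\mathbb R^N$ be a bounded, connected, open set with Lipschitz boundary (for instance the box $D=(-1,1)^N$). For $0<m\le|D|$ let $L^1_m(D,[0,1])$ be the set of measurable $\rho:D\to[0,1]$ with $\int_D\rho\,dx=m$, extended by $0$ outside $D$. For $\varepsilon>0$ let $\mu_k^\varepsilon(\rho):=\mu_k\big((\rho+\varepsilon)1_D,(\rho+\varepsilon^2)1_D\big)$, that is, the $k$-th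 eigenvalue of $$-\operatorname{div}\big((\rho+\varepsilon)\nabla u\big)=\mu\,(\rho+\varepsilon^2)\,u\ \text{ in } D,\qquad \partial_nu=0\ \text{ on }\partial D .$$ Then for every integer $k\ge 0$ the maximum of $\mu_k$ over $L^1_m(D,[0,1])$ and, for every $\varepsilon>0$, the maximum of $\mu_k^\varepsilon$ over $L^1_m(D,[0,1])$ are attained and finite, and $$\max_{\rho\in L^1_m(D,[0,1])}\mu_k^\varepsilon(\rho)\ \longrightarrow\ \max_{\rho\in L^1_m(D,[0,1])}\mu_k(\rho)\qquad\text{as }\varepsilon\to0^+ .$$ -/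

import Mathlib

open MeasureTheory Set Filter Topology
open scoped ENNReal NNReal ContDiff

/-- A set `D` in `ℝ^N` has Lipschitz boundary: near each of its boundary points, in a suitable
orthonormal frame whose last vector is `ν`, it is the strict subgraph of a Lipschitz function of
the remaining (orthogonal) variables. -/
def HasLipschitzBoundary {N : ℕ} (D : Set (EuclideanSpace ℝ (Fin N))) : Prop :=
  ∀ p ∈ frontier D, ∃ (ν : EuclideanSpace ℝ (Fin N)) (K : ℝ≥0)
    (γ : (Submodule.span ℝ {ν})ᗮ → ℝ),
    ‖ν‖ = 1 ∧ LipschitzWith K γ ∧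
      ∀ᶠ x in 𝓝 p,
        (x ∈ D ↔ inner ℝ ν x < γ ((Submodule.span ℝ {ν})ᗮ.orthogonalProjectionOnto x))

/-- The vector space `C_c^∞(ℝ^N)`. -/
def testFunctions (N : ℕ) : Submodule ℝ (EuclideanSpace ℝ (Fin N) → ℝ) where
  carrier := {u | ContDiff ℝ ∞ u ∧ HasCompactSupport u}
  add_mem' := fun hu hv => ⟨hu.1.add hv.1, hu.2.add hv.2⟩
  zero_mem' := ⟨contDiff_const, HasCompactSupport.zero⟩
  smul_mem' := fun c _ hu => ⟨contDiff_const.smul hu.1, hu.2.smul_left (f := fun _ => c)⟩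

/-- The Rayleigh quotient `∫ ρ₁ |∇u|² / ∫ ρ₂ u²`. -/
noncomputable def rayleighQuotient {N : ℕ} (ρ₁ ρ₂ u : EuclideanSpace ℝ (Fin N) → ℝ) : ℝ≥0∞ :=
  (∫⁻ x, ENNReal.ofReal (ρ₁ x) * ‖fderiv ℝ u x‖ₑ ^ 2) /
    (∫⁻ x, ENNReal.ofReal (ρ₂ x) * ‖u x‖ₑ ^ 2)

/-- `S` is a space of test functions whose truncations `u · 1_{ρ₂ > 0}`, `u ∈ S`, taken modulo
equality almost everywhere, form a space of dimension `d`. The map `u ↦ u · 1_{ρ₂ > 0}` is required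
to be injective on `S`, so that `S` is a lift of that `d`-dimensional space; every `d`-dimensional
space of truncations has such a lift. -/
structure IsTrialSpace {N : ℕ} (ρ₂ : EuclideanSpace ℝ (Fin N) → ℝ) (d : ℕ)
    (S : Submodule ℝ (EuclideanSpace ℝ (Fin N) → ℝ)) : Prop where
  le_testFunctions : S ≤ testFunctions N
  finiteDimensional : FiniteDimensional ℝ S
  finrank_eq : Module.finrank ℝ S = d
  injective : ∀ u ∈ S, (∀ᵐ x, 0 < ρ₂ x → u x = 0) → u = 0

/-- The `k`-th eigenvalue `μ_k(ρ₁, ρ₂)`, `k = 0, 1, 2, …`, of the possibly degenerate problem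
`-div (ρ₁ ∇u) = μ ρ₂ u` with Neumann boundary conditions:
the infimum over the `(k+1)`-dimensional spaces `S` of functions `u · 1_{ρ₂ > 0}`,
`u ∈ C_c^∞(ℝ^N)`, of the maximum over `S \ {0}` of the Rayleigh quotient.
It is `+∞` if `ρ₂ = 0` almost everywhere. -/
noncomputable def pairEigenvalue {N : ℕ} (k : ℕ) (ρ₁ ρ₂ : EuclideanSpace ℝ (Fin N) → ℝ) : ℝ≥0∞ :=
  ⨅ (S : Submodule ℝ (EuclideanSpace ℝ (Fin N) → ℝ)) (_ : IsTrialSpace ρ₂ (k + 1) S),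
    ⨆ (u : EuclideanSpace ℝ (Fin N) → ℝ) (_ : u ∈ S) (_ : u ≠ 0), rayleighQuotient ρ₁ ρ₂ u

/-- The `k`-th eigenvalue `μ_k(ρ)` of a density `ρ` on `ℝ^N`. -/
noncomputable def densityEigenvalue {N : ℕ} (k : ℕ) (ρ : EuclideanSpace ℝ (Fin N) → ℝ) : ℝ≥0∞ :=
  pairEigenvalue k ρ ρ

/-- The `k`-th eigenvalue `μ_k^ε(ρ)` of `-div ((ρ + ε) ∇u) = μ (ρ + ε²) u` on `D`, with
`∂ₙ u = 0` on `∂D`. -/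
noncomputable def regularizedEigenvalue {N : ℕ} (D : Set (EuclideanSpace ℝ (Fin N))) (k : ℕ)
    (ε : ℝ) (ρ : EuclideanSpace ℝ (Fin N) → ℝ) : ℝ≥0∞ :=
  pairEigenvalue k (D.indicator fun x => ρ x + ε) (D.indicator fun x => ρ x + ε ^ 2)

/-- The densities `ρ : D → [0, 1]` of mass `m`, extended by zero to `ℝ^N`. -/
def densitiesOfMass {N : ℕ} (D : Set (EuclideanSpace ℝ (Fin N))) (m : ℝ) :
    Set (EuclideanSpace ℝ (Fin N) → ℝ) :=
  {ρ | Measurable ρ ∧ (∀ x, ρ x ∈ Icc (0 : ℝ) 1) ∧ (∀ x, x ∉ D → ρ x = 0) ∧ ∫ x in D, ρ x = m}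

/-!
Maxima exist by the direct method. The set of densities of mass `m` is weak-* compact
(`exists_weightTendsto_of_mem_densitiesOfMass`: Banach-Alaoglu and Riesz representation in `L²(D)`).
For a fixed finite-dimensional space of test functions, the energy and mass forms depend
continuously on the weights, and strict inequalities between quadratic forms on a
finite-dimensional space are stable; being an infimum over such spaces, the eigenvalue is upper
semicontinuous in the pair of weights (`eventually_pairEigenvalue_le`). It is finite because the
polynomials in one coordinate, cut off away from `D`, remain linearly independent on every set of
positive measure (`exists_isTrialSpace`).

The same semicontinuity, applied along `ε → 0` to maximizers of the regularized problems, bounds the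
upper limit of the regularized maxima by the maximum of the degenerate problem.

The lower bound rests on the Poincaré inequality `∫_D u² ≤ C (∫_D |∇u|² + ∫ ρ u²)`
(`exists_weightedMass_indicator_one_le`), the only place where the regularity and the connectedness
of `D` are used. Multiplied by `ε²`, it shows that the additional mass `ε² ∫_D u²` is negligible
compared with the additional energy `ε ∫_D |∇u|²`, so that a trial space for the regularized problem
is one for the degenerate problem with almost the same Rayleigh quotients
(`densityEigenvalue_le_of_regularizedEigenvalue_lt`).

The Poincaré inequality itself is obtained without compact embeddings. If all segments from `A` to
`B` lie in `D`, then `∫_A ∫_B |u(x) - u(y)|²` is controlled by the energy on `D`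
(`poincareLinked_of_segment_subset`), and this relation between sets is transitive. A Lipschitz
domain is covered by finitely many pieces that are star-shaped with respect to balls, and any two
balls are linked by a chain since `D` is connected (`poincareLinked_self`).
-/

/-! ### Weighted energies, Rayleigh quotients and upper semicontinuity -/

/-- A nonnegative bounded measurable function on `ℝ^N` that vanishes outside `D`. -/
structure IsWeight {N : ℕ} (D : Set (EuclideanSpace ℝ (Fin N)))
    (w : EuclideanSpace ℝ (Fin N) → ℝ) : Prop where
  measurable : Measurable w
  nonneg : ∀ x, 0 ≤ w x
  eq_zero : ∀ x, x ∉ D → w x = 0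
  bounded : ∃ C : ℝ, ∀ x, w x ≤ C

lemma IsWeight.integrable_mul {N : ℕ} {D : Set (EuclideanSpace ℝ (Fin N))}
    {w : EuclideanSpace ℝ (Fin N) → ℝ} (hD : Bornology.IsBounded D) (hw : IsWeight D w)
    {f : EuclideanSpace ℝ (Fin N) → ℝ} (hf : Continuous f) :
    Integrable fun x => w x * f x := by
  obtain ⟨C, hC⟩ := hw.bounded
  have h1 : IntegrableOn f (closure D) := hf.continuousOn.integrableOn_compact hD.isCompact_closure
  have h2 : IntegrableOn (fun x => w x * f x) (closure D) := by
    refine Integrable.bdd_mul h1 (c := C) hw.measurable.aestronglyMeasurable ?_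
    exact Eventually.of_forall fun x => by
      rw [Real.norm_of_nonneg (hw.nonneg x)]; exact hC x
  rwa [integrableOn_iff_integrable_of_support_subset] at h2
  intro x hx
  by_contra h
  exact hx (by simp [hw.eq_zero x fun h' => h (subset_closure h')])

/-- The Dirichlet energy `∫ w |∇u|²`. -/
noncomputable def weightedEnergy {N : ℕ} (w u : EuclideanSpace ℝ (Fin N) → ℝ) : ℝ :=
  ∫ x, w x * ‖fderiv ℝ u x‖ ^ 2

/-- The weighted `L²` mass `∫ w u²`. -/
noncomputable def weightedMass {N : ℕ} (w u : EuclideanSpace ℝ (Fin N) → ℝ) : ℝ :=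
  ∫ x, w x * u x ^ 2

section Forms

variable {N : ℕ} {D : Set (EuclideanSpace ℝ (Fin N))} {w w₁ w₂ : EuclideanSpace ℝ (Fin N) → ℝ}

lemma continuous_fderiv_of_mem_testFunctions {u : EuclideanSpace ℝ (Fin N) → ℝ}
    (hu : u ∈ testFunctions N) : Continuous (fderiv ℝ u) :=
  ContDiff.continuous_fderiv (n := ∞) hu.1 (by simp)

lemma continuous_gradient_of_mem_testFunctions {u : EuclideanSpace ℝ (Fin N) → ℝ}
    (hu : u ∈ testFunctions N) : Continuous (gradient u) :=
  (InnerProductSpace.toDual ℝ _).symm.continuous.comp (continuous_fderiv_of_mem_testFunctions hu)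

lemma continuous_of_mem_testFunctions {u : EuclideanSpace ℝ (Fin N) → ℝ}
    (hu : u ∈ testFunctions N) : Continuous u :=
  ContDiff.continuous (n := ∞) hu.1

lemma weightedEnergy_nonneg (hw : IsWeight D w) (u : EuclideanSpace ℝ (Fin N) → ℝ) :
    0 ≤ weightedEnergy w u :=
  integral_nonneg fun x => mul_nonneg (hw.nonneg x) (by positivity)

lemma weightedMass_nonneg (hw : IsWeight D w) (u : EuclideanSpace ℝ (Fin N) → ℝ) :
    0 ≤ weightedMass w u :=
  integral_nonneg fun x => mul_nonneg (hw.nonneg x) (by positivity)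

lemma ofReal_weightedEnergy (hD : Bornology.IsBounded D) (hw : IsWeight D w)
    {u : EuclideanSpace ℝ (Fin N) → ℝ} (hu : u ∈ testFunctions N) :
    ENNReal.ofReal (weightedEnergy w u) =
      ∫⁻ x, ENNReal.ofReal (w x) * ‖fderiv ℝ u x‖ₑ ^ 2 := by
  rw [weightedEnergy, ofReal_integral_eq_lintegral_ofReal]
  · refine lintegral_congr fun x => ?_
    rw [ENNReal.ofReal_mul (hw.nonneg x), ENNReal.ofReal_pow (norm_nonneg _), ofReal_norm]
  · exact hw.integrable_mul hD (by have := continuous_fderiv_of_mem_testFunctions hu; fun_prop)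
  · exact Eventually.of_forall fun x => mul_nonneg (hw.nonneg x) (by positivity)

lemma ofReal_weightedMass (hD : Bornology.IsBounded D) (hw : IsWeight D w)
    {u : EuclideanSpace ℝ (Fin N) → ℝ} (hu : u ∈ testFunctions N) :
    ENNReal.ofReal (weightedMass w u) = ∫⁻ x, ENNReal.ofReal (w x) * ‖u x‖ₑ ^ 2 := by
  rw [weightedMass, ofReal_integral_eq_lintegral_ofReal]
  · refine lintegral_congr fun x => ?_
    rw [ENNReal.ofReal_mul (hw.nonneg x), ← ofReal_norm, ← ENNReal.ofReal_pow (norm_nonneg _),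
      Real.norm_eq_abs, sq_abs]
  · exact hw.integrable_mul hD (by have := continuous_of_mem_testFunctions hu; fun_prop)
  · exact Eventually.of_forall fun x => mul_nonneg (hw.nonneg x) (by positivity)

lemma rayleighQuotient_eq (hD : Bornology.IsBounded D) (hw₁ : IsWeight D w₁)
    (hw₂ : IsWeight D w₂) {u : EuclideanSpace ℝ (Fin N) → ℝ} (hu : u ∈ testFunctions N) :
    rayleighQuotient w₁ w₂ u =
      ENNReal.ofReal (weightedEnergy w₁ u) / ENNReal.ofReal (weightedMass w₂ u) := by
  rw [rayleighQuotient, ofReal_weightedEnergy hD hw₁ hu, ofReal_weightedMass hD hw₂ hu]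

lemma weightedMass_eq_zero_iff (hD : Bornology.IsBounded D) (hw : IsWeight D w)
    {u : EuclideanSpace ℝ (Fin N) → ℝ} (hu : u ∈ testFunctions N) :
    weightedMass w u = 0 ↔ ∀ᵐ x, 0 < w x → u x = 0 := by
  rw [weightedMass, integral_eq_zero_iff_of_nonneg
    (fun x => mul_nonneg (hw.nonneg x) (by positivity))
    (hw.integrable_mul hD (by have := continuous_of_mem_testFunctions hu; fun_prop))]
  refine eventually_congr (Eventually.of_forall fun x => ?_)
  have := hw.nonneg x
  simp only [Pi.zero_apply, mul_eq_zero, pow_eq_zero_iff two_ne_zero]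
  constructor
  · rintro (h | h) h'
    · exact absurd h h'.ne'
    · exact h
  · intro h
    rcases this.eq_or_lt with h' | h'
    · exact Or.inl h'.symm
    · exact Or.inr (h h')

lemma IsTrialSpace.weightedMass_pos (hD : Bornology.IsBounded D) (hw : IsWeight D w) {d : ℕ}
    {S : Submodule ℝ (EuclideanSpace ℝ (Fin N) → ℝ)} (hS : IsTrialSpace w d S)
    {u : EuclideanSpace ℝ (Fin N) → ℝ} (hu : u ∈ S) (hu0 : u ≠ 0) : 0 < weightedMass w u := by
  refine (weightedMass_nonneg hw u).lt_of_ne' fun h => hu0 (hS.injective u hu ?_)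
  exact (weightedMass_eq_zero_iff hD hw (hS.le_testFunctions hu)).1 h

lemma pairEigenvalue_le (hD : Bornology.IsBounded D) (hw₁ : IsWeight D w₁)
    (hw₂ : IsWeight D w₂) {k : ℕ} {S : Submodule ℝ (EuclideanSpace ℝ (Fin N) → ℝ)}
    (hS : S ≤ testFunctions N) (hfin : FiniteDimensional ℝ S)
    (hrank : Module.finrank ℝ S = k + 1) {c : ℝ}
    (hpos : ∀ u ∈ S, u ≠ 0 → 0 < weightedMass w₂ u)
    (hle : ∀ u ∈ S, u ≠ 0 → weightedEnergy w₁ u ≤ c * weightedMass w₂ u) :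
    pairEigenvalue k w₁ w₂ ≤ ENNReal.ofReal c := by
  have hT : IsTrialSpace w₂ (k + 1) S := by
    refine ⟨hS, hfin, hrank, fun u hu h => ?_⟩
    by_contra hu0
    exact (hpos u hu hu0).ne' ((weightedMass_eq_zero_iff hD hw₂ (hS hu)).2 h)
  refine iInf₂_le_of_le S hT (iSup_le fun u => iSup₂_le fun hu hu0 => ?_)
  rw [rayleighQuotient_eq hD hw₁ hw₂ (hS hu)]
  refine ENNReal.div_le_of_le_mul ?_
  rw [← ENNReal.ofReal_mul' (weightedMass_nonneg hw₂ u)]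
  exact ENNReal.ofReal_le_ofReal (hle u hu hu0)

lemma exists_of_pairEigenvalue_lt (hD : Bornology.IsBounded D) (hw₁ : IsWeight D w₁)
    (hw₂ : IsWeight D w₂) {k : ℕ} {c : ℝ≥0} (h : pairEigenvalue k w₁ w₂ < c) :
    ∃ S, IsTrialSpace w₂ (k + 1) S ∧
      ∃ c' : ℝ≥0, c' < c ∧ ∀ u ∈ S, weightedEnergy w₁ u ≤ c' * weightedMass w₂ u := by
  simp only [pairEigenvalue, iInf_lt_iff] at h
  obtain ⟨S, hS, h⟩ := h
  refine ⟨S, hS, ?_⟩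
  lift (⨆ (u : EuclideanSpace ℝ (Fin N) → ℝ) (_ : u ∈ S) (_ : u ≠ 0),
    rayleighQuotient w₁ w₂ u) to ℝ≥0 using h.ne_top with c' hc'
  refine ⟨c', by exact_mod_cast h, fun u hu => ?_⟩
  by_cases hu0 : u = 0
  · subst hu0
    simp [weightedEnergy, weightedMass]
  have h1 : rayleighQuotient w₁ w₂ u ≤ c' := by
    rw [hc']
    exact le_iSup_of_le u (le_iSup₂_of_le hu hu0 le_rfl)
  have hm := hS.weightedMass_pos hD hw₂ hu hu0
  rw [rayleighQuotient_eq hD hw₁ hw₂ (hS.le_testFunctions hu),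
    ENNReal.div_le_iff (by simpa using hm) (by simp), ← ENNReal.ofReal_coe_nnreal,
    ← ENNReal.ofReal_mul (by positivity), ENNReal.ofReal_le_ofReal_iff (by positivity)] at h1
  exact h1

/-- The bilinear form `(u, v) ↦ ∫ w ⟨∇u, ∇v⟩`. -/
noncomputable def energyForm (hD : Bornology.IsBounded D) (hw : IsWeight D w) :
    testFunctions N →ₗ[ℝ] testFunctions N →ₗ[ℝ] ℝ :=
  have hint (u v : testFunctions N) :
      Integrable fun x => w x * inner ℝ (gradient u.1 x) (gradient v.1 x) :=
    hw.integrable_mul hD ((continuous_gradient_of_mem_testFunctions u.2).inner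
      (continuous_gradient_of_mem_testFunctions v.2))
  have hd (u : testFunctions N) (x) : DifferentiableAt ℝ u.1 x :=
    (ContDiff.differentiable (n := ∞) u.2.1 (by simp)) x
  have hadd (u v : testFunctions N) (x) :
      gradient (u + v).1 x = gradient u.1 x + gradient v.1 x := by
    simp only [gradient, Submodule.coe_add, fderiv_add (hd u x) (hd v x), map_add]
  have hsmul (c : ℝ) (u : testFunctions N) (x) : gradient (c • u).1 x = c • gradient u.1 x := by
    have : (c • u).1 = c • u.1 := rfl
    rw [gradient, gradient, this, fderiv_const_smul (hd u x), map_smulₛₗ]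
    rfl
  LinearMap.mk₂ ℝ (fun u v => ∫ x, w x * inner ℝ (gradient u.1 x) (gradient v.1 x))
    (fun u u' v => by
      rw [← integral_add (hint u v) (hint u' v)]
      refine integral_congr_ae (Eventually.of_forall fun x => ?_)
      simp only [hadd, inner_add_left, mul_add])
    (fun c u v => by
      rw [smul_eq_mul, ← integral_const_mul]
      refine integral_congr_ae (Eventually.of_forall fun x => ?_)
      simp only [hsmul, real_inner_smul_left]
      ring)
    (fun u v v' => by
      rw [← integral_add (hint u v) (hint u v')]
      refine integral_congr_ae (Eventually.of_forall fun x => ?_)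
      simp only [hadd, inner_add_right, mul_add])
    (fun c u v => by
      rw [smul_eq_mul, ← integral_const_mul]
      refine integral_congr_ae (Eventually.of_forall fun x => ?_)
      simp only [hsmul, real_inner_smul_right]
      ring)

/-- The bilinear form `(u, v) ↦ ∫ w u v`. -/
noncomputable def massForm (hD : Bornology.IsBounded D) (hw : IsWeight D w) :
    testFunctions N →ₗ[ℝ] testFunctions N →ₗ[ℝ] ℝ :=
  have hint (u v : testFunctions N) : Integrable fun x => w x * (u.1 x * v.1 x) :=
    hw.integrable_mul hD ((continuous_of_mem_testFunctions u.2).mul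
      (continuous_of_mem_testFunctions v.2))
  LinearMap.mk₂ ℝ (fun u v => ∫ x, w x * (u.1 x * v.1 x))
    (fun u u' v => by
      rw [← integral_add (hint u v) (hint u' v)]
      refine integral_congr_ae (Eventually.of_forall fun x => ?_)
      simp; ring)
    (fun c u v => by
      rw [smul_eq_mul, ← integral_const_mul]
      refine integral_congr_ae (Eventually.of_forall fun x => ?_)
      simp; ring)
    (fun u v v' => by
      rw [← integral_add (hint u v) (hint u v')]
      refine integral_congr_ae (Eventually.of_forall fun x => ?_)
      simp; ring)
    (fun c u v => by
      rw [smul_eq_mul, ← integral_const_mul]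
      refine integral_congr_ae (Eventually.of_forall fun x => ?_)
      simp; ring)

lemma energyForm_apply (hD : Bornology.IsBounded D) (hw : IsWeight D w) (u v : testFunctions N) :
    energyForm hD hw u v = ∫ x, w x * inner ℝ (gradient u.1 x) (gradient v.1 x) := rfl

lemma massForm_apply (hD : Bornology.IsBounded D) (hw : IsWeight D w) (u v : testFunctions N) :
    massForm hD hw u v = ∫ x, w x * (u.1 x * v.1 x) := rfl

lemma energyForm_self (hD : Bornology.IsBounded D) (hw : IsWeight D w) (u : testFunctions N) :
    energyForm hD hw u u = weightedEnergy w u := by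
  simp only [energyForm_apply, weightedEnergy, real_inner_self_eq_norm_sq, gradient,
    LinearIsometryEquiv.norm_map]

lemma massForm_self (hD : Bornology.IsBounded D) (hw : IsWeight D w) (u : testFunctions N) :
    massForm hD hw u u = weightedMass w u := by
  simp only [massForm_apply, weightedMass, sq]

end Forms

/-- Positive definiteness is an open condition on the bilinear forms of a finite-dimensional space:
by compactness of the unit sphere, pointwise limits of forms are uniform there. -/
lemma eventually_posDef_of_tendsto {ι V : Type*} [AddCommGroup V] [Module ℝ V]
    [FiniteDimensional ℝ V] {l : Filter ι} {B : ι → V →ₗ[ℝ] V →ₗ[ℝ] ℝ} {B₀ : V →ₗ[ℝ] V →ₗ[ℝ] ℝ}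
    (hB : ∀ u v, Tendsto (fun i => B i u v) l (𝓝 (B₀ u v))) (hpos : ∀ u, u ≠ 0 → 0 < B₀ u u) :
    ∀ᶠ i in l, ∀ u, u ≠ 0 → 0 < B i u u := by
  let b := Module.finBasis ℝ V
  set d := Module.finrank ℝ V
  -- A form is recorded by its Gram matrix `G` in the basis `b`.
  let q : (Fin d → ℝ) → (Fin d → Fin d → ℝ) → ℝ := fun x G => ∑ j, ∑ k, x j * x k * G j k
  have hq : Continuous fun p : (Fin d → Fin d → ℝ) × (Fin d → ℝ) => q p.2 p.1 := by
    simp only [q]; fun_prop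
  have key (B : V →ₗ[ℝ] V →ₗ[ℝ] ℝ) (x : Fin d → ℝ) :
      B (b.equivFun.symm x) (b.equivFun.symm x) = q x fun j k => B (b j) (b k) := by
    simp only [Module.Basis.equivFun_symm_apply, map_sum, LinearMap.sum_apply, map_smul,
      LinearMap.smul_apply, smul_eq_mul, q, Finset.mul_sum]
    rw [Finset.sum_comm]
    exact Finset.sum_congr rfl fun j _ => Finset.sum_congr rfl fun k _ => by ring
  have hG : Tendsto (fun i => fun j k => B i (b j) (b k)) l (𝓝 fun j k => B₀ (b j) (b k)) :=
    tendsto_pi_nhds.2 fun j => tendsto_pi_nhds.2 fun k => hB _ _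
  have hK := (isCompact_sphere (0 : Fin d → ℝ) 1).eventually_forall_of_forall_eventually
    (x₀ := fun j k => B₀ (b j) (b k)) (P := fun G x => 0 < q x G) (by
      intro x hx
      refine hq.continuousAt.eventually (lt_mem_nhds ?_)
      simp only
      rw [← key]
      refine hpos _ fun h => ?_
      rw [LinearEquiv.map_eq_zero_iff] at h
      simp [h] at hx)
  filter_upwards [hG.eventually hK] with i hi u hu
  set x := b.equivFun u with hx
  have hxu : u = b.equivFun.symm x := by simp [hx]
  have hx0 : ‖x‖ ≠ 0 := by
    rw [norm_ne_zero_iff, hx]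
    exact fun h => hu (by simpa using h)
  have h1 := hi (‖x‖⁻¹ • x) (by simp [norm_smul, hx0])
  rw [← key, map_smul, ← hxu] at h1
  simp only [map_smul, LinearMap.smul_apply, smul_eq_mul] at h1
  have h2 : 0 < ‖x‖⁻¹ := by positivity
  exact (mul_pos_iff_of_pos_left h2).1 ((mul_pos_iff_of_pos_left h2).1 h1)

/-- Convergence of weights against continuous functions. For weights that are uniformly bounded and
vanish outside a bounded set, this is weak-* convergence in `L^∞`. -/
def WeightTendsto {ι : Type*} {N : ℕ} (w : ι → EuclideanSpace ℝ (Fin N) → ℝ) (l : Filter ι)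
    (w₀ : EuclideanSpace ℝ (Fin N) → ℝ) : Prop :=
  ∀ f : EuclideanSpace ℝ (Fin N) → ℝ, Continuous f →
    Tendsto (fun i => ∫ x, w i x * f x) l (𝓝 (∫ x, w₀ x * f x))

section Semicontinuity

variable {N : ℕ} {D : Set (EuclideanSpace ℝ (Fin N))}

/-- Upper semicontinuity of the eigenvalue for weak-* convergence of both weights: a trial space of
the limit problem is one for the nearby problems, with almost the same Rayleigh quotients. -/
lemma eventually_pairEigenvalue_le {ι : Type*} {l : Filter ι}
    (hD : Bornology.IsBounded D) {w₁ w₂ : ι → EuclideanSpace ℝ (Fin N) → ℝ}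
    {v₁ v₂ : EuclideanSpace ℝ (Fin N) → ℝ} (hw₁ : ∀ i, IsWeight D (w₁ i))
    (hw₂ : ∀ i, IsWeight D (w₂ i)) (hv₁ : IsWeight D v₁) (hv₂ : IsWeight D v₂)
    (h₁ : WeightTendsto w₁ l v₁) (h₂ : WeightTendsto w₂ l v₂) {k : ℕ} {c : ℝ≥0}
    (hc : pairEigenvalue k v₁ v₂ < c) :
    ∀ᶠ i in l, pairEigenvalue k (w₁ i) (w₂ i) ≤ c := by
  obtain ⟨S, hS, c', hc', hle⟩ := exists_of_pairEigenvalue_lt hD hv₁ hv₂ hc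
  have := hS.finiteDimensional
  let j := Submodule.inclusion hS.le_testFunctions
  have hmass (u v : S) : Tendsto (fun i => (massForm hD (hw₂ i)).compl₁₂ j j u v) l
      (𝓝 ((massForm hD hv₂).compl₁₂ j j u v)) :=
    h₂ _ ((continuous_of_mem_testFunctions (j u).2).mul (continuous_of_mem_testFunctions (j v).2))
  have henergy (u v : S) : Tendsto (fun i => (energyForm hD (hw₁ i)).compl₁₂ j j u v) l
      (𝓝 ((energyForm hD hv₁).compl₁₂ j j u v)) :=
    h₁ _ ((continuous_gradient_of_mem_testFunctions (j u).2).inner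
      (continuous_gradient_of_mem_testFunctions (j v).2))
  have hpos (u : S) (hu : u ≠ 0) : 0 < weightedMass v₂ u :=
    hS.weightedMass_pos hD hv₂ u.2 (by simpa using hu)
  -- Both the mass form and `c * mass - energy` are positive definite on `S` in the limit.
  have e₁ := eventually_posDef_of_tendsto hmass fun u hu => by
    simpa [massForm_self, j] using hpos u hu
  have e₂ := eventually_posDef_of_tendsto
    (B := fun i =>
      (c : ℝ) • (massForm hD (hw₂ i)).compl₁₂ j j - (energyForm hD (hw₁ i)).compl₁₂ j j)
    (B₀ := (c : ℝ) • (massForm hD hv₂).compl₁₂ j j - (energyForm hD hv₁).compl₁₂ j j)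
    (fun u v => ((hmass u v).const_mul (c : ℝ)).sub (henergy u v)) fun u hu => by
      have h3 := hle u u.2
      have h4 := mul_lt_mul_of_pos_right (NNReal.coe_lt_coe.2 hc') (hpos u hu)
      simp only [LinearMap.sub_apply, LinearMap.smul_apply, LinearMap.compl₁₂_apply, massForm_self,
        energyForm_self, smul_eq_mul, sub_pos]
      exact h3.trans_lt h4
  filter_upwards [e₁, e₂] with i hi₁ hi₂
  rw [← ENNReal.ofReal_coe_nnreal]
  refine pairEigenvalue_le hD (hw₁ i) (hw₂ i) hS.le_testFunctions this hS.finrank_eq ?_ ?_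
  · intro u hu hu0
    have := hi₁ ⟨u, hu⟩ (by simpa using hu0)
    simpa [massForm_self, j] using this
  · intro u hu hu0
    have := hi₂ ⟨u, hu⟩ (by simpa using hu0)
    simp only [LinearMap.sub_apply, LinearMap.smul_apply, LinearMap.compl₁₂_apply, massForm_self,
      energyForm_self, smul_eq_mul, sub_pos] at this
    exact this.le

end Semicontinuity

/-! ### Finiteness of the eigenvalues -/

section Finiteness

variable {N : ℕ} {D : Set (EuclideanSpace ℝ (Fin N))} {w w₁ w₂ : EuclideanSpace ℝ (Fin N) → ℝ}

lemma volume_setOf_eval_coord_eq_zero (i : Fin N) {p : Polynomial ℝ} (hp : p ≠ 0) :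
    volume {x : EuclideanSpace ℝ (Fin N) | p.eval (x i) = 0} = 0 := by
  have h1 : {x : EuclideanSpace ℝ (Fin N) | p.eval (x i) = 0} =
      ⋃ r ∈ p.roots.toFinset, {x : EuclideanSpace ℝ (Fin N) | x i = r} := by
    ext x
    simp [Polynomial.mem_roots', hp]
  rw [h1]
  refine (measure_biUnion_null_iff p.roots.toFinset.countable_toSet).2 fun r _ => ?_
  have h2 := (PiLp.volume_preserving_ofLp (Fin N)).measure_preimage
    (s := {f : Fin N → ℝ | f i = r})
    (measurableSet_eq_fun (measurable_pi_apply i) measurable_const).nullMeasurableSet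
  rw [volume_pi, Measure.pi_hyperplane (α := fun _ : Fin N => ℝ) (fun _ => volume) i r] at h2
  exact h2

/-- The products of polynomials of degree at most `k` in one coordinate with a cutoff function equal
to `1` on `D` form a trial space: a nonzero polynomial vanishes only on a null set. -/
lemma exists_isTrialSpace (hN : 1 ≤ N) (hD : Bornology.IsBounded D) (hw : IsWeight D w)
    (hpos : volume {x | 0 < w x} ≠ 0) (k : ℕ) : ∃ S, IsTrialSpace w (k + 1) S := by
  let i : Fin N := ⟨0, hN⟩
  obtain ⟨R, hR0, hR⟩ := hD.subset_closedBall_lt 0 (0 : EuclideanSpace ℝ (Fin N))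
  let χ : ContDiffBump (0 : EuclideanSpace ℝ (Fin N)) := ⟨R, R + 1, hR0, by linarith⟩
  let T : Polynomial ℝ →ₗ[ℝ] (EuclideanSpace ℝ (Fin N) → ℝ) :=
    { toFun := fun p x => χ x * p.eval (x i)
      map_add' := fun p q => by ext x; simp [mul_add]
      map_smul' := fun c p => by ext x; simp; ring }
  have hT (p : Polynomial ℝ) (h : ∀ᵐ x, 0 < w x → T p x = 0) : p = 0 := by
    by_contra hp
    refine hpos (measure_mono_null (fun x hx => ?_)
      (measure_union_null h (volume_setOf_eval_coord_eq_zero i hp)))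
    by_cases hx' : p.eval (x i) = 0
    · exact Or.inr hx'
    · refine Or.inl fun h' => hx' ?_
      have hxD : x ∈ D := by
        by_contra hxD
        exact hx.ne' (hw.eq_zero x hxD)
      have h1 : χ x = 1 := χ.one_of_mem_closedBall (hR hxD)
      simpa [T, h1] using h' hx
  have hinj : Function.Injective T := by
    rw [injective_iff_map_eq_zero]
    exact fun p hp => hT p (Eventually.of_forall fun x _ => by rw [hp]; rfl)
  have hfin : FiniteDimensional ℝ (Polynomial.degreeLT ℝ (k + 1)) :=
    (Polynomial.degreeLTEquiv ℝ (k + 1)).symm.finiteDimensional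
  refine ⟨(Polynomial.degreeLT ℝ (k + 1)).map T, ?_, inferInstance, ?_, ?_⟩
  · rintro _ ⟨p, -, rfl⟩
    refine ⟨?_, χ.hasCompactSupport.mul_right⟩
    have h1 : ContDiff ℝ ∞ fun x : EuclideanSpace ℝ (Fin N) => p.eval (x i) :=
      (p.contDiff_aeval ∞).comp (contDiff_piLp_apply (p := 2) (i := i))
    exact χ.contDiff.mul h1
  · rw [← (Submodule.equivMapOfInjective T hinj _).finrank_eq,
      (Polynomial.degreeLTEquiv ℝ (k + 1)).finrank_eq, Module.finrank_fin_fun]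
  · rintro _ ⟨p, -, rfl⟩ h
    rw [hT p h, map_zero]

lemma pairEigenvalue_lt_top (hN : 1 ≤ N) (hD : Bornology.IsBounded D) (hw₁ : IsWeight D w₁)
    (hw₂ : IsWeight D w₂) (hpos : volume {x | 0 < w₂ x} ≠ 0) (k : ℕ) :
    pairEigenvalue k w₁ w₂ < ⊤ := by
  obtain ⟨S, hS⟩ := exists_isTrialSpace hN hD hw₂ hpos k
  have := hS.finiteDimensional
  let j := Submodule.inclusion hS.le_testFunctions
  let A := (energyForm hD hw₁).compl₁₂ j j
  let B := (massForm hD hw₂).compl₁₂ j j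
  have hB (u : S) (hu : u ≠ 0) : 0 < weightedMass w₂ u :=
    hS.weightedMass_pos hD hw₂ u.2 (by simpa using hu)
  -- For small `s` the form `B - s A` is still positive definite, so `1 / s` bounds the quotient.
  have hev := eventually_posDef_of_tendsto (l := 𝓝[>] (0 : ℝ)) (B := fun s => B - s • A) (B₀ := B)
    (fun u v => by
      have h1 : Tendsto (fun s : ℝ => B u v - s * A u v) (𝓝 0) (𝓝 (B u v - 0 * A u v)) :=
        Continuous.tendsto (by fun_prop) 0
      simp only [zero_mul, sub_zero] at h1
      exact h1.mono_left nhdsWithin_le_nhds)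
    fun u hu => by simpa [B, massForm_self, j] using hB u hu
  obtain ⟨s, hs, hs0⟩ := (hev.and self_mem_nhdsWithin).exists
  have hs0 : 0 < s := hs0
  refine (pairEigenvalue_le hD hw₁ hw₂ hS.le_testFunctions this hS.finrank_eq (c := s⁻¹)
    ?_ ?_).trans_lt ENNReal.ofReal_lt_top
  · exact fun u hu hu0 => hB ⟨u, hu⟩ (by simpa using hu0)
  · intro u hu hu0
    have h2 := hs ⟨u, hu⟩ (by simpa using hu0)
    simp only [LinearMap.sub_apply, LinearMap.smul_apply, LinearMap.compl₁₂_apply, massForm_self,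
      energyForm_self, smul_eq_mul, sub_pos, A, B] at h2
    rw [inv_mul_eq_div, le_div_iff₀ hs0, mul_comm]
    exact h2.le

end Finiteness

/-! ### Weak-* compactness of the densities -/

section WeakCompactness

/-- Weak compactness of the functions with values in `[0, 1]` on a finite measure space. The limit
is found by the Banach-Alaoglu theorem and the Riesz representation theorem in `L²`. -/
lemma exists_weak_limit_of_mem_Icc {α ι : Type*} [MeasurableSpace α] (μ : Measure α)
    [IsFiniteMeasure μ] (𝒰 : Ultrafilter ι) {f : ι → α → ℝ} (hf : ∀ i, Measurable (f i))
    (hf01 : ∀ i x, f i x ∈ Icc (0 : ℝ) 1) :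
    ∃ g : α → ℝ, Measurable g ∧ (∀ x, g x ∈ Icc (0 : ℝ) 1) ∧
      ∀ h : α → ℝ, MemLp h 2 μ →
        Tendsto (fun i => ∫ x, f i x * h x ∂μ) 𝒰 (𝓝 (∫ x, g x * h x ∂μ)) := by
  have hb (i) : ∀ᵐ x ∂μ, ‖f i x‖ ≤ 1 := Eventually.of_forall fun x => by
    rw [Real.norm_of_nonneg (hf01 i x).1]; exact (hf01 i x).2
  have hL (i) : MemLp (f i) 2 μ := MemLp.of_bound (hf i).aestronglyMeasurable 1 (hb i)
  let ℓ : ι → WeakDual ℝ (Lp ℝ 2 μ) := fun i =>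
    StrongDual.toWeakDual (InnerProductSpace.toDual ℝ (Lp ℝ 2 μ) (hL i).toLp)
  obtain ⟨R, hR⟩ : ∃ R : ℝ, ∀ i, ‖(hL i).toLp‖ ≤ R := by
    refine ⟨_, fun i => Lp.norm_le_of_ae_bound zero_le_one ?_⟩
    filter_upwards [(hL i).coeFn_toLp, hb i] with x hx hx'
    rwa [hx]
  obtain ⟨ℓ₀, -, hℓ₀⟩ := (WeakDual.isCompact_closedBall (0 : StrongDual ℝ (Lp ℝ 2 μ)) R
    ).ultrafilter_le_nhds (𝒰.map ℓ) (by
      rw [le_principal_iff, Ultrafilter.mem_coe, Ultrafilter.mem_map]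
      refine univ_mem' fun i => mem_closedBall_zero_iff.2 ?_
      exact ((InnerProductSpace.toDual ℝ (Lp ℝ 2 μ)).norm_map _).trans_le (hR i))
  set G : Lp ℝ 2 μ := (InnerProductSpace.toDual ℝ (Lp ℝ 2 μ)).symm (WeakDual.toStrongDual ℓ₀)
  have hlim (h : α → ℝ) (hh : MemLp h 2 μ) :
      Tendsto (fun i => ∫ x, f i x * h x ∂μ) 𝒰 (𝓝 (∫ x, G x * h x ∂μ)) := by
    have h1 : Tendsto (fun i => ℓ i hh.toLp) 𝒰 (𝓝 (ℓ₀ hh.toLp)) :=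
      (WeakDual.eval_continuous hh.toLp).continuousAt.tendsto.comp hℓ₀
    have h2 : ℓ₀ hh.toLp = ∫ x, G x * h x ∂μ := by
      have : ℓ₀ hh.toLp = inner ℝ G hh.toLp := by
        rw [InnerProductSpace.toDual_symm_apply]; rfl
      rw [this, L2.inner_def]
      refine integral_congr_ae ?_
      filter_upwards [hh.coeFn_toLp] with x hx
      rw [hx]; simp [mul_comm]
    have h3 (i) : ℓ i hh.toLp = ∫ x, f i x * h x ∂μ := by
      have : ℓ i hh.toLp = inner ℝ (hL i).toLp hh.toLp := rfl
      rw [this, L2.inner_def]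
      refine integral_congr_ae ?_
      filter_upwards [hh.coeFn_toLp, (hL i).coeFn_toLp] with x hx hx'
      rw [hx, hx']; simp [mul_comm]
    rw [h2] at h1
    simpa only [h3] using h1
  have hGi : Integrable G μ := (Lp.memLp G).integrable (by norm_num)
  have hset (s : Set α) (hs : MeasurableSet s) :
      Tendsto (fun i => ∫ x in s, f i x ∂μ) 𝒰 (𝓝 (∫ x in s, G x ∂μ)) := by
    have h1 := hlim (s.indicator 1) ((memLp_const (1 : ℝ)).indicator hs)
    have h2 (F : α → ℝ) : (∫ x, F x * s.indicator 1 x ∂μ) = ∫ x in s, F x ∂μ := by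
      rw [← integral_indicator hs]
      congr 1; ext x
      by_cases hx : x ∈ s <;> simp [hx]
    simpa only [h2] using h1
  have hG0 : 0 ≤ᵐ[μ] G := ae_nonneg_of_forall_setIntegral_nonneg hGi fun s hs _ =>
    ge_of_tendsto' (hset s hs) fun i => integral_nonneg fun x => (hf01 i x).1
  have hG1 : G ≤ᵐ[μ] fun _ => (1 : ℝ) :=
    ae_le_of_forall_setIntegral_le hGi (integrable_const 1) fun s hs _ =>
      le_of_tendsto' (hset s hs) fun i => integral_mono
        ((hL i).integrable (by norm_num)).integrableOn (integrable_const 1) fun x => (hf01 i x).2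
  refine ⟨fun x => max 0 (min 1 (G x)), measurable_const.max (measurable_const.min
    (Lp.stronglyMeasurable G).measurable), fun x => ⟨le_max_left _ _,
      max_le zero_le_one (min_le_left _ _)⟩, fun h hh => ?_⟩
  convert! hlim h hh using 2
  refine integral_congr_ae ?_
  filter_upwards [hG0, hG1] with x h0 h1
  rw [min_eq_right h1, max_eq_right (show 0 ≤ G x from h0)]

variable {N : ℕ} {D : Set (EuclideanSpace ℝ (Fin N))} {m : ℝ}

lemma isWeight_of_mem_densitiesOfMass {ρ : EuclideanSpace ℝ (Fin N) → ℝ}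
    (hρ : ρ ∈ densitiesOfMass D m) : IsWeight D ρ :=
  ⟨hρ.1, fun x => (hρ.2.1 x).1, hρ.2.2.1, 1, fun x => (hρ.2.1 x).2⟩

lemma isWeight_indicator_one (hD : IsOpen D) : IsWeight D (D.indicator fun _ => (1 : ℝ)) :=
  ⟨measurable_const.indicator hD.measurableSet,
    fun _ => indicator_nonneg (fun _ _ => zero_le_one) _,
    fun _ hx => indicator_of_notMem hx _, 1,
    fun _ => indicator_apply_le' (fun _ => le_rfl) fun _ => zero_le_one⟩

lemma isWeight_indicator_add_const {ρ : EuclideanSpace ℝ (Fin N) → ℝ} (hD : IsOpen D)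
    (hρ : ρ ∈ densitiesOfMass D m) {c : ℝ} (hc : 0 ≤ c) :
    IsWeight D (D.indicator fun x => ρ x + c) := by
  refine ⟨(hρ.1.add_const c).indicator hD.measurableSet, fun x => ?_, fun x hx => ?_, 1 + c,
    fun x => ?_⟩
  · exact indicator_nonneg (fun y _ => add_nonneg (hρ.2.1 y).1 hc) x
  · exact indicator_of_notMem hx _
  · refine indicator_apply_le' (fun _ => ?_) fun _ => by positivity
    exact add_le_add_left (hρ.2.1 x).2 c

lemma memLp_restrict_of_continuous (hD : Bornology.IsBounded D)
    {f : EuclideanSpace ℝ (Fin N) → ℝ} (hf : Continuous f) :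
    MemLp f 2 (volume.restrict D) := by
  rw [memLp_two_iff_integrable_sq hf.aestronglyMeasurable.restrict]
  exact ((hf.pow 2).continuousOn.integrableOn_compact hD.isCompact_closure).mono_set subset_closure

lemma integral_indicator_add_const_mul (hDo : IsOpen D) (hD : Bornology.IsBounded D)
    {ρ : EuclideanSpace ℝ (Fin N) → ℝ} (hρ : ρ ∈ densitiesOfMass D m) (c : ℝ)
    {f : EuclideanSpace ℝ (Fin N) → ℝ} (hf : Continuous f) :
    ∫ x, D.indicator (fun x => ρ x + c) x * f x = (∫ x, ρ x * f x) + c * ∫ x in D, f x := by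
  rw [← integral_const_mul, ← integral_indicator hDo.measurableSet, ← integral_add
    ((isWeight_of_mem_densitiesOfMass hρ).integrable_mul hD hf)]
  · congr 1; ext x
    by_cases hx : x ∈ D
    · simp [hx]; ring
    · simp [hx, hρ.2.2.1 x hx]
  · rw [integrable_indicator_iff hDo.measurableSet]
    exact ((hf.continuousOn.integrableOn_compact hD.isCompact_closure).mono_set
      subset_closure).const_mul c

/-- Weak-* compactness of the set of densities of mass `m`. -/
lemma exists_weightTendsto_of_mem_densitiesOfMass {ι : Type*} (𝒰 : Ultrafilter ι)
    (hDo : IsOpen D) (hD : Bornology.IsBounded D) {ρ : ι → EuclideanSpace ℝ (Fin N) → ℝ}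
    (hρ : ∀ i, ρ i ∈ densitiesOfMass D m) :
    ∃ ρ₀ ∈ densitiesOfMass D m, WeightTendsto ρ 𝒰 ρ₀ := by
  have : IsFiniteMeasure (volume.restrict D) := ⟨by simpa using hD.measure_lt_top⟩
  obtain ⟨g, hg, hg01, hlim⟩ := exists_weak_limit_of_mem_Icc (volume.restrict D) 𝒰
    (fun i => (hρ i).1) fun i => (hρ i).2.1
  refine ⟨D.indicator g, ⟨hg.indicator hDo.measurableSet, fun x => ?_, fun x hx => ?_, ?_⟩,
    fun f hf => ?_⟩
  · by_cases hx : x ∈ D <;> simp [hx, (hg01 x).1, (hg01 x).2]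
  · exact indicator_of_notMem hx _
  · rw [setIntegral_indicator hDo.measurableSet, inter_self]
    have h1 := hlim (fun _ => 1) (memLp_const 1)
    simp only [mul_one] at h1
    refine tendsto_nhds_unique h1 ?_
    simp only [fun i => (hρ i).2.2.2]
    exact tendsto_const_nhds
  · have h1 := hlim f (memLp_restrict_of_continuous hD hf)
    have h2 (F : EuclideanSpace ℝ (Fin N) → ℝ) (hF : ∀ x, x ∉ D → F x = 0) :
        ∫ x in D, F x * f x = ∫ x, F x * f x :=
      setIntegral_eq_integral_of_forall_compl_eq_zero fun x hx => by rw [hF x hx, zero_mul]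
    have h3 : ∫ x in D, g x * f x = ∫ x, D.indicator g x * f x := by
      rw [← h2 _ fun x hx => indicator_of_notMem hx _]
      exact setIntegral_congr_fun hDo.measurableSet fun x hx => by simp [hx]
    rw [h3] at h1
    simpa only [fun i => h2 _ (hρ i).2.2.1] using h1

/-- Adding constants `c i → c₀` on `D` is compatible with weak-* convergence. -/
lemma WeightTendsto.indicator_add_const {ι : Type*} {l : Filter ι} (hDo : IsOpen D)
    (hD : Bornology.IsBounded D) {ρ : ι → EuclideanSpace ℝ (Fin N) → ℝ}
    {ρ₀ : EuclideanSpace ℝ (Fin N) → ℝ} (hρ : ∀ i, ρ i ∈ densitiesOfMass D m)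
    (hρ₀ : ρ₀ ∈ densitiesOfMass D m) (h : WeightTendsto ρ l ρ₀) {c : ι → ℝ} {c₀ : ℝ}
    (hc : Tendsto c l (𝓝 c₀)) :
    WeightTendsto (fun i => D.indicator fun x => ρ i x + c i) l
      (D.indicator fun x => ρ₀ x + c₀) := by
  intro f hf
  rw [integral_indicator_add_const_mul hDo hD hρ₀ c₀ hf]
  simp only [integral_indicator_add_const_mul hDo hD (hρ _) _ hf]
  exact (h f hf).add (hc.mul_const _)

end WeakCompactness

/-! ### Mean square differences along segments -/

section Poincare

variable {N : ℕ}

/-- The mean square difference of the values of a `C¹` function on `A` and on `B` is controlled by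
its Dirichlet energy on `D`. -/
def PoincareLinked (D A B : Set (EuclideanSpace ℝ (Fin N))) : Prop :=
  ∃ C : ℝ≥0∞, C ≠ ⊤ ∧ ∀ u : EuclideanSpace ℝ (Fin N) → ℝ, ContDiff ℝ 1 u →
    ∫⁻ x in A, ∫⁻ y in B, ‖u x - u y‖ₑ ^ 2 ≤ C * ∫⁻ z in D, ‖fderiv ℝ u z‖ₑ ^ 2

variable {D A B E : Set (EuclideanSpace ℝ (Fin N))}

lemma PoincareLinked.symm (h : PoincareLinked D A B) : PoincareLinked D B A := by
  obtain ⟨C, hC, h⟩ := h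
  refine ⟨C, hC, fun u hu => le_of_eq_of_le ?_ (h u hu)⟩
  have hc := hu.continuous
  rw [lintegral_lintegral_swap]
  · refine lintegral_congr fun x => lintegral_congr fun y => ?_
    rw [← enorm_neg, neg_sub]
  · have : Continuous fun p : EuclideanSpace ℝ (Fin N) × EuclideanSpace ℝ (Fin N) =>
        ‖u p.1 - u p.2‖ₑ ^ 2 := by fun_prop
    exact this.measurable.aemeasurable

lemma PoincareLinked.mono_left (h : PoincareLinked D A B) (hE : E ⊆ A) :
    PoincareLinked D E B := by
  obtain ⟨C, hC, h⟩ := h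
  exact ⟨C, hC, fun u hu => (lintegral_mono_set hE).trans (h u hu)⟩

lemma PoincareLinked.mono_right (h : PoincareLinked D A B) (hE : E ⊆ B) :
    PoincareLinked D A E :=
  (h.symm.mono_left hE).symm

lemma PoincareLinked.union_left (h : PoincareLinked D A B) (h' : PoincareLinked D E B) :
    PoincareLinked D (A ∪ E) B := by
  obtain ⟨C, hC, h⟩ := h
  obtain ⟨C', hC', h'⟩ := h'
  refine ⟨C + C', ENNReal.add_ne_top.2 ⟨hC, hC'⟩, fun u hu => ?_⟩
  rw [add_mul]
  exact (lintegral_union_le _ _ _).trans (add_le_add (h u hu) (h' u hu))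

lemma enorm_sub_sq_le (a b c : ℝ) :
    ‖a - c‖ₑ ^ 2 ≤ 2 * ‖a - b‖ₑ ^ 2 + 2 * ‖b - c‖ₑ ^ 2 := by
  simp only [← ofReal_norm, Real.norm_eq_abs, ← ENNReal.ofReal_pow (abs_nonneg _), sq_abs]
  rw [← ENNReal.ofReal_ofNat 2, ← ENNReal.ofReal_mul (by norm_num),
    ← ENNReal.ofReal_mul (by norm_num), ← ENNReal.ofReal_add (by positivity) (by positivity)]
  refine ENNReal.ofReal_le_ofReal ?_
  nlinarith [sq_nonneg ((a - b) - (b - c))]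

/-- Transitivity: average the inequality `|u x - u z|² ≤ 2 |u x - u y|² + 2 |u y - u z|²` over the
intermediate set. -/
lemma PoincareLinked.trans (h : PoincareLinked D A B) (h' : PoincareLinked D B E)
    (hA : volume A ≠ ⊤) (hE : volume E ≠ ⊤) (hB : volume B ≠ 0) (hB' : volume B ≠ ⊤) :
    PoincareLinked D A E := by
  obtain ⟨C, hC, h⟩ := h
  obtain ⟨C', hC', h'⟩ := h'
  refine ⟨(volume B)⁻¹ * (2 * (volume E * C) + 2 * (volume A * C')), by finiteness,
    fun u hu => ?_⟩
  have hc := hu.continuous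
  have hm1 (x) : Measurable fun y => ‖u x - u y‖ₑ ^ 2 :=
    (by fun_prop : Continuous fun y => ‖u x - u y‖ₑ ^ 2).measurable
  have hm2 : Measurable fun p : EuclideanSpace ℝ (Fin N) × EuclideanSpace ℝ (Fin N) =>
      ‖u p.1 - u p.2‖ₑ ^ 2 :=
    (by fun_prop : Continuous fun p : EuclideanSpace ℝ (Fin N) × EuclideanSpace ℝ (Fin N) =>
      ‖u p.1 - u p.2‖ₑ ^ 2).measurable
  set G := ∫⁻ z in D, ‖fderiv ℝ u z‖ₑ ^ 2
  have key (x z) : volume B * ‖u x - u z‖ₑ ^ 2 ≤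
      2 * (∫⁻ y in B, ‖u x - u y‖ₑ ^ 2) + 2 * ∫⁻ y in B, ‖u z - u y‖ₑ ^ 2 := by
    calc volume B * ‖u x - u z‖ₑ ^ 2 = ∫⁻ y in B, ‖u x - u z‖ₑ ^ 2 := by
          rw [setLIntegral_const, mul_comm]
      _ ≤ ∫⁻ y in B, (2 * ‖u x - u y‖ₑ ^ 2 + 2 * ‖u z - u y‖ₑ ^ 2) := by
          refine lintegral_mono fun y => ?_
          have := enorm_sub_sq_le (u x) (u y) (u z)
          rwa [← enorm_neg (u y - u z), neg_sub] at this
      _ = _ := by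
          rw [lintegral_add_left ((hm1 x).const_mul 2), lintegral_const_mul _ (hm1 x),
            lintegral_const_mul _ (hm1 z)]
  have hmB : Measurable fun x => ∫⁻ y in B, ‖u x - u y‖ₑ ^ 2 := hm2.lintegral_prod_right'
  have h2 : ∫⁻ z in E, ∫⁻ y in B, ‖u z - u y‖ₑ ^ 2 ≤ C' * G := by
    refine le_of_eq_of_le ?_ (h' u hu)
    rw [lintegral_lintegral_swap hm2.aemeasurable]
    refine lintegral_congr fun x => lintegral_congr fun y => ?_
    rw [← enorm_neg, neg_sub]
  have step : volume B * ∫⁻ x in A, ∫⁻ z in E, ‖u x - u z‖ₑ ^ 2 ≤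
      (2 * (volume E * C) + 2 * (volume A * C')) * G := by
    calc volume B * ∫⁻ x in A, ∫⁻ z in E, ‖u x - u z‖ₑ ^ 2
        = ∫⁻ x in A, ∫⁻ z in E, volume B * ‖u x - u z‖ₑ ^ 2 := by
          rw [← lintegral_const_mul' _ _ hB']
          exact lintegral_congr fun x => (lintegral_const_mul' _ _ hB').symm
      _ ≤ ∫⁻ x in A, ∫⁻ z in E,
            (2 * (∫⁻ y in B, ‖u x - u y‖ₑ ^ 2) + 2 * ∫⁻ y in B, ‖u z - u y‖ₑ ^ 2) :=
          lintegral_mono fun x => lintegral_mono fun z => key x z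
      _ = ∫⁻ x in A, (2 * volume E * (∫⁻ y in B, ‖u x - u y‖ₑ ^ 2) +
            2 * ∫⁻ z in E, ∫⁻ y in B, ‖u z - u y‖ₑ ^ 2) := by
          refine lintegral_congr fun x => ?_
          rw [lintegral_add_left measurable_const, setLIntegral_const, lintegral_const_mul _ hmB]
          ring
      _ = 2 * volume E * (∫⁻ x in A, ∫⁻ y in B, ‖u x - u y‖ₑ ^ 2) +
            2 * (∫⁻ z in E, ∫⁻ y in B, ‖u z - u y‖ₑ ^ 2) * volume A := by
          rw [lintegral_add_left (hmB.const_mul _), lintegral_const_mul _ hmB, setLIntegral_const]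
      _ ≤ 2 * volume E * (C * G) + 2 * (C' * G) * volume A := by
          gcongr
          exact h u hu
      _ = _ := by ring
  rw [mul_assoc, mul_comm (volume B)⁻¹, ← div_eq_mul_inv, ENNReal.le_div_iff_mul_le (Or.inl hB)
    (Or.inl hB'), mul_comm]
  exact step

lemma sq_lintegral_le_lintegral_sq {α : Type*} [MeasurableSpace α] {μ : Measure α}
    [IsProbabilityMeasure μ] {f : α → ℝ≥0∞} (hf : AEMeasurable f μ) :
    (∫⁻ x, f x ∂μ) ^ 2 ≤ ∫⁻ x, f x ^ 2 ∂μ := by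
  have h := ENNReal.lintegral_mul_le_Lp_mul_Lq μ Real.HolderConjugate.two_two hf
    (aemeasurable_const (b := (1 : ℝ≥0∞)))
  simp only [Pi.mul_apply, mul_one, one_pow, ENNReal.one_rpow, lintegral_const, measure_univ,
    ENNReal.rpow_ofNat] at h
  calc (∫⁻ x, f x ∂μ) ^ 2 ≤ ((∫⁻ x, f x ^ 2 ∂μ) ^ (1 / 2 : ℝ)) ^ 2 := by gcongr
    _ = _ := by
      rw [← ENNReal.rpow_natCast, ← ENNReal.rpow_mul]
      norm_num

lemma enorm_sub_sq_le_lintegral {u : EuclideanSpace ℝ (Fin N) → ℝ} (hu : ContDiff ℝ 1 u)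
    (x y : EuclideanSpace ℝ (Fin N)) :
    ‖u x - u y‖ₑ ^ 2 ≤
      ‖y - x‖ₑ ^ 2 * ∫⁻ t in Icc (0 : ℝ) 1, ‖fderiv ℝ u (x + t • (y - x))‖ₑ ^ 2 := by
  have hc : Continuous fun t : ℝ => ‖fderiv ℝ u (x + t • (y - x))‖ₑ := by
    have := hu.continuous_fderiv one_ne_zero
    fun_prop
  have : IsProbabilityMeasure (volume.restrict (Icc (0 : ℝ) 1)) := ⟨by simp⟩
  have hder (t : ℝ) : HasDerivAt (fun t : ℝ => u (x + t • (y - x)))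
      (fderiv ℝ u (x + t • (y - x)) (y - x)) t := by
    have h1 : HasDerivAt (fun t : ℝ => x + t • (y - x)) (y - x) t := by
      simpa using ((hasDerivAt_id t).smul_const (y - x)).const_add x
    exact (hu.differentiable one_ne_zero _).hasFDerivAt.comp_hasDerivAt t h1
  have h1 : ‖u y - u x‖ₑ ≤ ∫⁻ t in Icc (0 : ℝ) 1, ‖fderiv ℝ u (x + t • (y - x)) (y - x)‖ₑ := by
    have h2 := enorm_sub_le_lintegral_deriv_of_contDiffOn_Icc (a := 0) (b := 1)
      (f := fun t : ℝ => u (x + t • (y - x)))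
      (hu.comp (by fun_prop)).contDiffOn zero_le_one
    simpa [fun t => (hder t).deriv] using h2
  calc ‖u x - u y‖ₑ ^ 2 = ‖u y - u x‖ₑ ^ 2 := by rw [← enorm_neg, neg_sub]
    _ ≤ (∫⁻ t in Icc (0 : ℝ) 1, ‖y - x‖ₑ * ‖fderiv ℝ u (x + t • (y - x))‖ₑ) ^ 2 := by
        gcongr
        refine h1.trans (lintegral_mono fun t => ?_)
        rw [mul_comm]
        exact ContinuousLinearMap.le_opENorm _ _
    _ = ‖y - x‖ₑ ^ 2 * (∫⁻ t in Icc (0 : ℝ) 1, ‖fderiv ℝ u (x + t • (y - x))‖ₑ) ^ 2 := by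
        rw [lintegral_const_mul _ hc.measurable, mul_pow]
    _ ≤ _ := by
        gcongr
        exact sq_lintegral_le_lintegral_sq hc.measurable.aemeasurable

lemma lintegral_comp_add_smul {g : EuclideanSpace ℝ (Fin N) → ℝ≥0∞} (hg : Measurable g)
    (a : EuclideanSpace ℝ (Fin N)) {t : ℝ} (ht : t ≠ 0) :
    ∫⁻ y, g (a + t • y) = ENNReal.ofReal |(t ^ N)⁻¹| * ∫⁻ z, g z := by
  have h1 : ∫⁻ y, g (a + t • y) = ∫⁻ z, g (a + z) ∂(Measure.map (t • ·) volume) :=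
    (lintegral_map (hg.comp (measurable_const_add a)) (measurable_const_smul t)).symm
  rw [h1, Measure.map_addHaar_smul _ ht, lintegral_smul_measure, lintegral_add_left_eq_self,
    finrank_euclideanSpace_fin, smul_eq_mul]

lemma lintegral_comp_add_smul_le {g : EuclideanSpace ℝ (Fin N) → ℝ≥0∞} (hg : Measurable g)
    (a : EuclideanSpace ℝ (Fin N)) {t : ℝ} (ht : 1 / 2 ≤ t) :
    ∫⁻ y, g (a + t • y) ≤ 2 ^ N * ∫⁻ z, g z := by
  rw [lintegral_comp_add_smul hg a (by linarith)]
  gcongr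
  have h0 : (0 : ℝ) < t := by linarith
  rw [abs_of_pos (by positivity), ← inv_pow, ENNReal.ofReal_pow (by positivity)]
  gcongr
  rw [← ENNReal.ofReal_ofNat 2]
  refine ENNReal.ofReal_le_ofReal ?_
  rw [inv_le_comm₀ h0 (by norm_num)]
  linarith

/-- If all segments joining `A` to `B` lie in `D`, integrate the derivative along these segments. At
time `t` the point `(1 - t) x + t y` is a dilation of ratio at least `1 / 2` of `y` (if `t ≥ 1 / 2`)
or of `x` (if `t ≤ 1 / 2`), so that the change of variables costs at most a factor `2 ^ N`. -/
lemma poincareLinked_of_segment_subset (hD : MeasurableSet D) (hDb : Bornology.IsBounded D)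
    (hA : MeasurableSet A) (hB : MeasurableSet B)
    (h : ∀ x ∈ A, ∀ y ∈ B, segment ℝ x y ⊆ D) (hAD : A ⊆ D) (hBD : B ⊆ D) :
    PoincareLinked D A B := by
  refine ⟨Metric.ediam D ^ 2 * (2 ^ N * volume D), ?_, fun u hu => ?_⟩
  · have h1 : Metric.ediam D ≠ ⊤ := hDb.ediam_ne_top
    have h2 : volume D ≠ ⊤ := hDb.measure_lt_top.ne
    finiteness
  have hfc := hu.continuous_fderiv one_ne_zero
  have hg0 : Measurable fun z => ‖fderiv ℝ u z‖ₑ ^ 2 :=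
    (by fun_prop : Continuous fun z => ‖fderiv ℝ u z‖ₑ ^ 2).measurable
  set g : EuclideanSpace ℝ (Fin N) → ℝ≥0∞ := D.indicator fun z => ‖fderiv ℝ u z‖ₑ ^ 2 with hgdef
  have hg : Measurable g := hg0.indicator hD
  have hG : ∫⁻ z in D, ‖fderiv ℝ u z‖ₑ ^ 2 = ∫⁻ z, g z := (lintegral_indicator hD _).symm
  rw [hG]
  set G := ∫⁻ z, g z
  have hAB (t : ℝ) : ∫⁻ x in A, ∫⁻ y in B, g (x + t • (y - x)) ≤ 2 ^ N * volume D * G := by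
    rcases le_total (1 / 2) t with ht | ht
    · calc ∫⁻ x in A, ∫⁻ y in B, g (x + t • (y - x)) ≤ ∫⁻ x in A, 2 ^ N * G := by
            refine lintegral_mono fun x => (setLIntegral_le_lintegral _ _).trans ?_
            refine le_of_eq_of_le (lintegral_congr fun y => ?_)
              (lintegral_comp_add_smul_le hg ((1 - t) • x) ht)
            congr 1; module
        _ = 2 ^ N * G * volume A := setLIntegral_const _ _
        _ ≤ 2 ^ N * G * volume D := by gcongr
        _ = _ := by ring
    · have hm : Measurable fun p : EuclideanSpace ℝ (Fin N) × EuclideanSpace ℝ (Fin N) =>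
          g (p.1 + t • (p.2 - p.1)) := hg.comp (by fun_prop)
      calc ∫⁻ x in A, ∫⁻ y in B, g (x + t • (y - x))
          = ∫⁻ y in B, ∫⁻ x in A, g (x + t • (y - x)) :=
            lintegral_lintegral_swap hm.aemeasurable
        _ ≤ ∫⁻ y in B, 2 ^ N * G := by
            refine lintegral_mono fun y => (setLIntegral_le_lintegral _ _).trans ?_
            refine le_of_eq_of_le (lintegral_congr fun x => ?_)
              (lintegral_comp_add_smul_le hg (t • y) (t := 1 - t) (by linarith))
            congr 1; module
        _ = 2 ^ N * G * volume B := setLIntegral_const _ _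
        _ ≤ 2 ^ N * G * volume D := by gcongr
        _ = _ := by ring
  have hm3 : Measurable fun p : (EuclideanSpace ℝ (Fin N) × ℝ) × EuclideanSpace ℝ (Fin N) =>
      g (p.1.1 + p.1.2 • (p.2 - p.1.1)) := hg.comp (by fun_prop)
  have hm2 (x : EuclideanSpace ℝ (Fin N)) : Measurable fun p : EuclideanSpace ℝ (Fin N) × ℝ =>
      g (x + p.2 • (p.1 - x)) := hg.comp (by fun_prop)
  calc ∫⁻ x in A, ∫⁻ y in B, ‖u x - u y‖ₑ ^ 2
      ≤ ∫⁻ x in A, ∫⁻ y in B,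
          Metric.ediam D ^ 2 * ∫⁻ t in Icc (0 : ℝ) 1, g (x + t • (y - x)) := by
        refine setLIntegral_mono' hA fun x hx => setLIntegral_mono' hB fun y hy => ?_
        refine (enorm_sub_sq_le_lintegral hu x y).trans ?_
        gcongr ?_ ^ 2 * ?_
        · rw [← edist_eq_enorm_sub]
          exact Metric.edist_le_ediam_of_mem (hBD hy) (hAD hx)
        · refine (setLIntegral_congr_fun measurableSet_Icc fun t ht => ?_).le
          rw [hgdef, indicator_of_mem]
          refine h x hx y hy ?_
          rw [segment_eq_image']
          exact ⟨t, ht, rfl⟩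
    _ = Metric.ediam D ^ 2 *
          ∫⁻ x in A, ∫⁻ y in B, ∫⁻ t in Icc (0 : ℝ) 1, g (x + t • (y - x)) := by
        rw [← lintegral_const_mul' _ _ (by have := hDb.ediam_ne_top; finiteness)]
        exact lintegral_congr fun x =>
          lintegral_const_mul' _ _ (by have := hDb.ediam_ne_top; finiteness)
    _ = Metric.ediam D ^ 2 *
          ∫⁻ x in A, ∫⁻ t in Icc (0 : ℝ) 1, ∫⁻ y in B, g (x + t • (y - x)) := by
        congr 1
        exact lintegral_congr fun x => lintegral_lintegral_swap (hm2 x).aemeasurable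
    _ = Metric.ediam D ^ 2 *
          ∫⁻ t in Icc (0 : ℝ) 1, ∫⁻ x in A, ∫⁻ y in B, g (x + t • (y - x)) := by
        congr 1
        exact lintegral_lintegral_swap hm3.lintegral_prod_right'.aemeasurable
    _ ≤ Metric.ediam D ^ 2 * ∫⁻ t in Icc (0 : ℝ) 1, 2 ^ N * volume D * G := by
        gcongr with t
        exact hAB t
    _ = _ := by
        rw [setLIntegral_const, Real.volume_Icc]
        simp [mul_assoc]

end Poincare

/-! ### The Poincaré inequality on Lipschitz domains -/

section LipschitzDomain

variable {N : ℕ} {D : Set (EuclideanSpace ℝ (Fin N))}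

/-- Near a boundary point of a Lipschitz domain, the domain is star-shaped with respect to a ball,
placed below the graph along `-ν` at a distance that beats the Lipschitz constant. -/
lemma HasLipschitzBoundary.exists_ball_segment_subset (hD : HasLipschitzBoundary D)
    {p : EuclideanSpace ℝ (Fin N)} (hp : p ∈ frontier D) :
    ∃ (c : EuclideanSpace ℝ (Fin N)) (δ : ℝ), 0 < δ ∧ Metric.ball c δ ⊆ D ∧
      ∀ x ∈ Metric.ball p δ ∩ D, ∀ y ∈ Metric.ball c δ, segment ℝ x y ⊆ D := by
  obtain ⟨ν, K, γ, hν, hγ, hloc⟩ := hD p hp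
  obtain ⟨R, hR, hball⟩ := Metric.eventually_nhds_iff_ball.1 hloc
  set P := (Submodule.span ℝ {ν})ᗮ.orthogonalProjectionOnto
  have hPν : P ν = 0 :=
    Submodule.orthogonalProjectionOnto_orthogonalComplement_singleton_eq_zero ν
  have hK : (0 : ℝ) ≤ K := K.2
  -- Along a segment of relative time `t` the height drops by at least `t (R / 2 - 2 δ)`, the graph
  -- by at most `2 K δ t`; this `δ` makes the two equal.
  set δ := R / (4 * (1 + K)) with hδ
  have hδ0 : 0 < δ := by positivity
  have hδR : δ * (1 + K) = R / 4 := by rw [hδ]; field_simp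
  have hδR' : δ ≤ R / 4 := by nlinarith
  have hseg : ∀ x ∈ Metric.ball p δ ∩ D, ∀ y ∈ Metric.ball (p - (R / 2) • ν) δ,
      segment ℝ x y ⊆ D := by
    rintro x ⟨hxp, hxD⟩ y hy z hz
    have hxR : x ∈ Metric.ball p R := Metric.ball_subset_ball (by linarith) hxp
    rw [mem_ball_iff_norm] at hxp hy
    have hyR : y ∈ Metric.ball p R := by
      rw [mem_ball_iff_norm]
      calc ‖y - p‖ = ‖(y - (p - (R / 2) • ν)) - (R / 2) • ν‖ := by congr 1; abel
        _ ≤ ‖y - (p - (R / 2) • ν)‖ + ‖(R / 2) • ν‖ := norm_sub_le _ _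
        _ < R := by rw [norm_smul, hν, Real.norm_of_nonneg (by positivity)]; linarith
    have hzR : z ∈ Metric.ball p R := (convex_ball p R).segment_subset hxR hyR hz
    rw [segment_eq_image'] at hz
    obtain ⟨t, ⟨ht0, ht1⟩, rfl⟩ := hz
    refine (hball _ hzR).2 ?_
    have hx := (hball x hxR).1 hxD
    set e := (y - (p - (R / 2) • ν)) - (x - p) with he
    have he' : ‖e‖ ≤ 2 * δ := (norm_sub_le _ _).trans (by linarith)
    have hyx : y - x = e - (R / 2) • ν := by rw [he]; abel
    have hin : inner ℝ ν (x + t • (y - x)) = inner ℝ ν x + t * (inner ℝ ν e - R / 2) := by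
      rw [hyx, inner_add_right, real_inner_smul_right, inner_sub_right, real_inner_smul_right,
        real_inner_self_eq_norm_sq, hν]
      ring
    have hine : inner ℝ ν e ≤ 2 * δ := by
      have := real_inner_le_norm ν e
      rw [hν, one_mul] at this
      exact this.trans he'
    have hPe : ‖P e‖ ≤ 2 * δ := (Submodule.norm_orthogonalProjectionOnto_apply_le _ e).trans he'
    have hPz : P (x + t • (y - x)) = P x + t • P e := by
      rw [hyx, map_add, map_smul, map_sub, map_smul, hPν, smul_zero, sub_zero]
    have hγz : γ (P x) - K * (t * (2 * δ)) ≤ γ (P (x + t • (y - x))) := by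
      have h1 := hγ.dist_le_mul (P x) (P x + t • P e)
      rw [dist_self_add_right, norm_smul, Real.norm_of_nonneg ht0, Real.dist_eq] at h1
      have h2 : (K : ℝ) * (t * ‖P e‖) ≤ K * (t * (2 * δ)) := by gcongr
      rw [hPz]
      linarith [le_abs_self (γ (P x) - γ (P x + t • P e))]
    rw [hin]
    refine lt_of_lt_of_le ?_ hγz
    have h3 : t * inner ℝ ν e ≤ t * (2 * δ) := by gcongr
    have h4 : t * (δ * (1 + K)) = t * (R / 4) := by rw [hδR]
    nlinarith
  refine ⟨p - (R / 2) • ν, δ, hδ0, fun y hy => ?_, hseg⟩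
  obtain ⟨x, hxD, hx⟩ := Metric.mem_closure_iff.1 (frontier_subset_closure hp) δ hδ0
  exact hseg x ⟨Metric.mem_ball'.2 hx, hxD⟩ y hy (right_mem_segment ℝ x y)

lemma poincareLinked_ball_ball (hDo : IsOpen D) (hDb : Bornology.IsBounded D)
    {x : EuclideanSpace ℝ (Fin N)} {r : ℝ} (hr : Metric.ball x r ⊆ D) :
    PoincareLinked D (Metric.ball x r) (Metric.ball x r) :=
  poincareLinked_of_segment_subset hDo.measurableSet hDb measurableSet_ball measurableSet_ball
    (fun _ hy _ hz => ((convex_ball x r).segment_subset hy hz).trans hr) hr hr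

lemma PoincareLinked.trans_of_subset_ball {A B E : Set (EuclideanSpace ℝ (Fin N))}
    {x : EuclideanSpace ℝ (Fin N)} {r : ℝ} (hDb : Bornology.IsBounded D) (hr : 0 < r)
    (hA : A ⊆ D) (hE : E ⊆ D) (hB : Metric.ball x r ⊆ B) (h : PoincareLinked D A B)
    (h' : PoincareLinked D (Metric.ball x r) E) : PoincareLinked D A E :=
  (h.mono_right hB).trans h' (hDb.subset hA).measure_lt_top.ne (hDb.subset hE).measure_lt_top.ne
    (Metric.measure_ball_pos _ x hr).ne' measure_ball_lt_top.ne

lemma IsConnected.exists_poincareLinked_balls (hDo : IsOpen D) (hDb : Bornology.IsBounded D)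
    (hDc : IsConnected D) {x y : EuclideanSpace ℝ (Fin N)} (hx : x ∈ D) (hy : y ∈ D) :
    ∃ r, 0 < r ∧ Metric.ball x r ⊆ D ∧ Metric.ball y r ⊆ D ∧
      PoincareLinked D (Metric.ball x r) (Metric.ball y r) := by
  refine hDc.isPreconnected.induction₂ (fun x y => ∃ r, 0 < r ∧ Metric.ball x r ⊆ D ∧
    Metric.ball y r ⊆ D ∧ PoincareLinked D (Metric.ball x r) (Metric.ball y r)) ?_ ?_ ?_ hx hy
  · intro x hx
    obtain ⟨r, hr, hrD⟩ := Metric.isOpen_iff.1 hDo x hx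
    filter_upwards [mem_nhdsWithin_of_mem_nhds (Metric.ball_mem_nhds x (half_pos hr))] with y hy
    have hsub : Metric.ball y (r / 2) ⊆ Metric.ball x r :=
      Metric.ball_subset_ball' (by linarith [Metric.mem_ball.1 hy])
    exact ⟨r / 2, half_pos hr, (Metric.ball_subset_ball (by linarith)).trans hrD, hsub.trans hrD,
      ((poincareLinked_ball_ball hDo hDb hrD).mono_left (Metric.ball_subset_ball (by linarith))
        ).mono_right hsub⟩
  · rintro x y z - - - ⟨r, hr, hrx, hry, h⟩ ⟨s, hs, hsy, hsz, h'⟩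
    have h1 : Metric.ball y (min r s) ⊆ Metric.ball y r := Metric.ball_subset_ball (min_le_left _ _)
    have h2 : Metric.ball y (min r s) ⊆ Metric.ball y s :=
      Metric.ball_subset_ball (min_le_right _ _)
    have h3 : Metric.ball x (min r s) ⊆ Metric.ball x r := Metric.ball_subset_ball (min_le_left _ _)
    have h4 : Metric.ball z (min r s) ⊆ Metric.ball z s :=
      Metric.ball_subset_ball (min_le_right _ _)
    exact ⟨min r s, lt_min hr hs, h3.trans hrx, h4.trans hsz,
      (h.mono_left h3).trans_of_subset_ball hDb (lt_min hr hs) (h3.trans hrx) (h4.trans hsz) h1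
        ((h'.mono_left h2).mono_right h4)⟩
  · rintro x y - - ⟨r, hr, hrx, hry, h⟩
    exact ⟨r, hr, hry, hrx, h.symm⟩

/-- The Poincaré inequality on a bounded connected Lipschitz domain: finitely many star-shaped
pieces cover `D`, and chains of balls in `D` link each of them to a fixed ball. -/
lemma poincareLinked_self (hDo : IsOpen D) (hDb : Bornology.IsBounded D) (hDc : IsConnected D)
    (hDl : HasLipschitzBoundary D) : PoincareLinked D D D := by
  obtain ⟨x₀, hx₀⟩ := hDc.nonempty
  obtain ⟨r₀, hr₀, hrD⟩ := Metric.isOpen_iff.1 hDo x₀ hx₀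
  have hloc : ∀ p ∈ closure D, ∃ (c : EuclideanSpace ℝ (Fin N)) (δ : ℝ), 0 < δ ∧
      Metric.ball c δ ⊆ D ∧ PoincareLinked D (Metric.ball p δ ∩ D) (Metric.ball c δ) := by
    intro p hp
    by_cases hpD : p ∈ D
    · obtain ⟨r, hr, hrD⟩ := Metric.isOpen_iff.1 hDo p hpD
      exact ⟨p, r, hr, hrD, (poincareLinked_ball_ball hDo hDb hrD).mono_left inter_subset_left⟩
    · have hpf : p ∈ frontier D := by rw [hDo.frontier_eq]; exact ⟨hp, hpD⟩
      obtain ⟨c, δ, hδ, hcD, hseg⟩ := hDl.exists_ball_segment_subset hpf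
      exact ⟨c, δ, hδ, hcD, poincareLinked_of_segment_subset hDo.measurableSet hDb
        (measurableSet_ball.inter hDo.measurableSet) measurableSet_ball hseg inter_subset_right hcD⟩
  have hD₀ : PoincareLinked D (closure D ∩ D) (Metric.ball x₀ r₀) := by
    refine hDb.isCompact_closure.induction_on
      (p := fun s => PoincareLinked D (s ∩ D) (Metric.ball x₀ r₀)) ?_ ?_ ?_ ?_
    · exact ⟨0, ENNReal.zero_ne_top, fun u _ => by simp⟩
    · exact fun s t hst h => h.mono_left (inter_subset_inter_left D hst)
    · intro s t hs ht
      rw [union_inter_distrib_right]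
      exact hs.union_left ht
    · intro p hp
      obtain ⟨c, δ, hδ, hcD, h⟩ := hloc p hp
      refine ⟨Metric.ball p δ, mem_nhdsWithin_of_mem_nhds (Metric.ball_mem_nhds p hδ), ?_⟩
      obtain ⟨r, hr, hrc, hrx, h'⟩ := hDc.exists_poincareLinked_balls hDo hDb
        (hcD (Metric.mem_ball_self hδ)) hx₀
      have h1 : Metric.ball c (min δ r) ⊆ Metric.ball c δ :=
        Metric.ball_subset_ball (min_le_left _ _)
      have h2 : Metric.ball c (min δ r) ⊆ Metric.ball c r :=
        Metric.ball_subset_ball (min_le_right _ _)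
      have h3 : Metric.ball x₀ (min r r₀) ⊆ Metric.ball x₀ r :=
        Metric.ball_subset_ball (min_le_left _ _)
      have h4 : Metric.ball x₀ (min r r₀) ⊆ Metric.ball x₀ r₀ :=
        Metric.ball_subset_ball (min_le_right _ _)
      exact (h.trans_of_subset_ball hDb (lt_min hδ hr) inter_subset_right hrx h1
        (h'.mono_left h2)).trans_of_subset_ball hDb (lt_min hr hr₀) inter_subset_right hrD h3
          ((poincareLinked_ball_ball hDo hDb hrD).mono_left h4)
  rw [inter_eq_self_of_subset_right subset_closure] at hD₀
  exact hD₀.trans_of_subset_ball hDb hr₀ subset_rfl subset_rfl subset_rfl hD₀.symm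

/-- Averaging the Poincaré inequality against a density `ρ` of positive mass bounds the `L²` norm on
`D` by the Dirichlet energy on `D` and the `ρ`-mass. -/
lemma exists_weightedMass_indicator_one_le (hDo : IsOpen D) (hDb : Bornology.IsBounded D)
    (hDc : IsConnected D) (hDl : HasLipschitzBoundary D) {m : ℝ} (hm : 0 < m) :
    ∃ C : ℝ, 0 ≤ C ∧ ∀ ρ ∈ densitiesOfMass D m, ∀ u ∈ testFunctions N,
      weightedMass (D.indicator fun _ => 1) u ≤
        C * (weightedEnergy (D.indicator fun _ => 1) u + weightedMass ρ u) := by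
  obtain ⟨C, hC, hP⟩ := poincareLinked_self hDo hDb hDc hDl
  have hvol : volume D ≠ ⊤ := hDb.measure_lt_top.ne
  refine ⟨m⁻¹ * (2 * (C + volume D)).toReal, by positivity, fun ρ hρ u hu => ?_⟩
  have h1D := isWeight_indicator_one hDo
  have hρw := isWeight_of_mem_densitiesOfMass hρ
  have hcu := continuous_of_mem_testFunctions hu
  have hind (f : EuclideanSpace ℝ (Fin N) → ℝ≥0∞) :
      ∫⁻ x, ENNReal.ofReal (D.indicator (fun _ => 1) x) * f x = ∫⁻ x in D, f x := by
    rw [← lintegral_indicator hDo.measurableSet]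
    refine lintegral_congr fun x => ?_
    by_cases hx : x ∈ D <;> simp [hx]
  have hmass : ∫⁻ y in D, ENNReal.ofReal (ρ y) = ENNReal.ofReal m := by
    rw [← hρ.2.2.2, ofReal_integral_eq_lintegral_ofReal]
    · have h1 := hρw.integrable_mul hDb (continuous_const (y := (1 : ℝ)))
      simp only [mul_one] at h1
      exact h1.restrict
    · exact Eventually.of_forall hρw.nonneg
  have hρm : Measurable fun y => ENNReal.ofReal (ρ y) := hρ.1.ennreal_ofReal
  have hum : Measurable fun y => ‖u y‖ₑ ^ 2 :=
    (by fun_prop : Continuous fun y => ‖u y‖ₑ ^ 2).measurable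
  have hpt (x y) : ENNReal.ofReal (ρ y) * ‖u x‖ₑ ^ 2 ≤
      2 * ‖u x - u y‖ₑ ^ 2 + 2 * (ENNReal.ofReal (ρ y) * ‖u y‖ₑ ^ 2) := by
    have h1 : ENNReal.ofReal (ρ y) ≤ 1 := ENNReal.ofReal_le_one.2 (hρ.2.1 y).2
    have h2 := enorm_sub_sq_le (u x) (u y) 0
    simp only [sub_zero] at h2
    calc ENNReal.ofReal (ρ y) * ‖u x‖ₑ ^ 2
        ≤ ENNReal.ofReal (ρ y) * (2 * ‖u x - u y‖ₑ ^ 2 + 2 * ‖u y‖ₑ ^ 2) := by gcongr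
      _ = ENNReal.ofReal (ρ y) * (2 * ‖u x - u y‖ₑ ^ 2) +
            2 * (ENNReal.ofReal (ρ y) * ‖u y‖ₑ ^ 2) := by ring
      _ ≤ _ := add_le_add_left (mul_le_of_le_one_left' h1) _
  have hm1 (x) : Measurable fun y => ‖u x - u y‖ₑ ^ 2 :=
    (by fun_prop : Continuous fun y => ‖u x - u y‖ₑ ^ 2).measurable
  have hm2 : Measurable fun p : EuclideanSpace ℝ (Fin N) × EuclideanSpace ℝ (Fin N) =>
      ‖u p.1 - u p.2‖ₑ ^ 2 :=
    (by fun_prop : Continuous fun p : EuclideanSpace ℝ (Fin N) × EuclideanSpace ℝ (Fin N) =>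
      ‖u p.1 - u p.2‖ₑ ^ 2).measurable
  have key : ENNReal.ofReal m * ∫⁻ x in D, ‖u x‖ₑ ^ 2 ≤
      2 * (C + volume D) * ((∫⁻ z in D, ‖fderiv ℝ u z‖ₑ ^ 2) +
        ∫⁻ y, ENNReal.ofReal (ρ y) * ‖u y‖ₑ ^ 2) := by
    calc ENNReal.ofReal m * ∫⁻ x in D, ‖u x‖ₑ ^ 2
        = ∫⁻ x in D, ∫⁻ y in D, ENNReal.ofReal (ρ y) * ‖u x‖ₑ ^ 2 := by
          rw [← lintegral_const_mul _ hum]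
          refine lintegral_congr fun x => ?_
          rw [lintegral_mul_const _ hρm, hmass]
      _ ≤ ∫⁻ x in D, ∫⁻ y in D,
            (2 * ‖u x - u y‖ₑ ^ 2 + 2 * (ENNReal.ofReal (ρ y) * ‖u y‖ₑ ^ 2)) :=
          lintegral_mono fun x => lintegral_mono fun y => hpt x y
      _ = 2 * (∫⁻ x in D, ∫⁻ y in D, ‖u x - u y‖ₑ ^ 2) +
            2 * (∫⁻ y in D, ENNReal.ofReal (ρ y) * ‖u y‖ₑ ^ 2) * volume D := by
          rw [← lintegral_const_mul _ hm2.lintegral_prod_right', ← setLIntegral_const,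
            ← lintegral_add_right _ measurable_const]
          refine lintegral_congr fun x => ?_
          rw [lintegral_add_left ((hm1 x).const_mul 2), lintegral_const_mul _ (hm1 x),
            lintegral_const_mul _ (show Measurable fun y => ENNReal.ofReal (ρ y) * ‖u y‖ₑ ^ 2 from
              hρm.mul hum)]
      _ ≤ 2 * (C * ∫⁻ z in D, ‖fderiv ℝ u z‖ₑ ^ 2) +
            2 * (∫⁻ y, ENNReal.ofReal (ρ y) * ‖u y‖ₑ ^ 2) * volume D := by
          gcongr
          · exact hP u (hu.1.of_le (by simp))
          · exact Measure.restrict_le_self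
      _ ≤ 2 * ((C + volume D) * ∫⁻ z in D, ‖fderiv ℝ u z‖ₑ ^ 2) +
            2 * (∫⁻ y, ENNReal.ofReal (ρ y) * ‖u y‖ₑ ^ 2) * (C + volume D) := by
          gcongr
          · exact le_self_add
          · exact le_add_self
      _ = _ := by ring
  rw [← hind, ← hind, ← ofReal_weightedMass hDb h1D hu, ← ofReal_weightedEnergy hDb h1D hu,
    ← ofReal_weightedMass hDb hρw hu,
    ← ENNReal.ofReal_toReal (a := 2 * (C + volume D)) (by finiteness),
    ← ENNReal.ofReal_add (weightedEnergy_nonneg h1D u) (weightedMass_nonneg hρw u),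
    ← ENNReal.ofReal_mul hm.le, ← ENNReal.ofReal_mul ENNReal.toReal_nonneg,
    ENNReal.ofReal_le_ofReal_iff (mul_nonneg ENNReal.toReal_nonneg
      (add_nonneg (weightedEnergy_nonneg h1D u) (weightedMass_nonneg hρw u)))] at key
  rw [mul_assoc, inv_mul_eq_div, le_div_iff₀ hm, mul_comm]
  exact key

end LipschitzDomain

/-! ### Comparison of the regularized and the degenerate problem -/

section Regularization

variable {N : ℕ} {D : Set (EuclideanSpace ℝ (Fin N))} {m : ℝ}
  {ρ u : EuclideanSpace ℝ (Fin N) → ℝ}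

lemma integral_indicator_one_mul (hDo : IsOpen D) (f : EuclideanSpace ℝ (Fin N) → ℝ) :
    ∫ x, D.indicator (fun _ => (1 : ℝ)) x * f x = ∫ x in D, f x := by
  rw [← integral_indicator hDo.measurableSet]
  congr 1; ext x
  by_cases hx : x ∈ D <;> simp [hx]

lemma weightedMass_indicator_add_const (hDo : IsOpen D) (hD : Bornology.IsBounded D)
    (hρ : ρ ∈ densitiesOfMass D m) (c : ℝ) (hu : u ∈ testFunctions N) :
    weightedMass (D.indicator fun x => ρ x + c) u =
      weightedMass ρ u + c * weightedMass (D.indicator fun _ => 1) u := by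
  have := continuous_of_mem_testFunctions hu
  rw [weightedMass, integral_indicator_add_const_mul hDo hD hρ c (by fun_prop), weightedMass,
    weightedMass, integral_indicator_one_mul hDo]

lemma weightedEnergy_indicator_add_const (hDo : IsOpen D) (hD : Bornology.IsBounded D)
    (hρ : ρ ∈ densitiesOfMass D m) (c : ℝ) (hu : u ∈ testFunctions N) :
    weightedEnergy (D.indicator fun x => ρ x + c) u =
      weightedEnergy ρ u + c * weightedEnergy (D.indicator fun _ => 1) u := by
  have := continuous_fderiv_of_mem_testFunctions hu
  rw [weightedEnergy, integral_indicator_add_const_mul hDo hD hρ c (by fun_prop), weightedEnergy,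
    weightedEnergy, integral_indicator_one_mul hDo]

/-- The regularized problem controls the degenerate one. By the Poincaré inequality the extra mass
`ε² ∫_D u²` is at most `C ε` times the extra energy `ε ∫_D |∇u|²`, up to `C ε² ∫ ρ u²`; this is
where the regularization of the mass must be of smaller order than that of the energy. -/
lemma densityEigenvalue_le_of_regularizedEigenvalue_lt (hDo : IsOpen D)
    (hD : Bornology.IsBounded D) {C : ℝ} (hC : 0 ≤ C)
    (hP : ∀ ρ ∈ densitiesOfMass D m, ∀ u ∈ testFunctions N,
      weightedMass (D.indicator fun _ => 1) u ≤
        C * (weightedEnergy (D.indicator fun _ => 1) u + weightedMass ρ u))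
    (hρ : ρ ∈ densitiesOfMass D m) {k : ℕ} {ε : ℝ} (hε : 0 < ε) {a : ℝ≥0}
    (ha : regularizedEigenvalue D k ε ρ < a) (haε : a * C * ε < 1) :
    densityEigenvalue k ρ ≤ ENNReal.ofReal (a * (1 + C * ε ^ 2) / (1 - a * C * ε)) := by
  have hρw := isWeight_of_mem_densitiesOfMass hρ
  have hw₂ := isWeight_indicator_add_const hDo hρ (sq_nonneg ε)
  obtain ⟨S, hS, a', ha', hle⟩ := exists_of_pairEigenvalue_lt hD
    (isWeight_indicator_add_const hDo hρ hε.le) hw₂ ha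
  have h1D := isWeight_indicator_one hDo
  have hδ : 0 < 1 - a * C * ε := by linarith
  have key : ∀ u ∈ S, (1 - a * C * ε) *
      (weightedEnergy ρ u + ε * weightedEnergy (D.indicator fun _ => 1) u) ≤
        a * (1 + C * ε ^ 2) * weightedMass ρ u := by
    intro u hu
    have hut := hS.le_testFunctions hu
    have h1 := hle u hu
    have h2 : (a' : ℝ) * weightedMass (D.indicator fun x => ρ x + ε ^ 2) u ≤
        a * weightedMass (D.indicator fun x => ρ x + ε ^ 2) u :=
      mul_le_mul_of_nonneg_right (NNReal.coe_le_coe.2 ha'.le) (weightedMass_nonneg hw₂ u)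
    have h3 := h1.trans h2
    rw [weightedEnergy_indicator_add_const hDo hD hρ ε hut,
      weightedMass_indicator_add_const hDo hD hρ _ hut] at h3
    have h4 : (a : ℝ) * ε ^ 2 * weightedMass (D.indicator fun _ => 1) u ≤ a * ε ^ 2 *
        (C * (weightedEnergy (D.indicator fun _ => 1) u + weightedMass ρ u)) :=
      mul_le_mul_of_nonneg_left (hP ρ hρ u hut) (by positivity)
    have h5 : 0 ≤ a * C * ε * weightedEnergy ρ u :=
      mul_nonneg (by positivity) (weightedEnergy_nonneg hρw u)
    linarith
  refine pairEigenvalue_le hD hρw hρw hS.le_testFunctions hS.finiteDimensional hS.finrank_eq ?_ ?_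
  · intro u hu hu0
    have hut := hS.le_testFunctions hu
    refine (weightedMass_nonneg hρw u).lt_of_ne' fun h0 => ?_
    -- If `∫ ρ u² = 0`, then `∇u = 0` on `D`, hence `∫_D u² = 0` by the Poincaré inequality.
    have h1 := key u hu
    rw [h0, mul_zero] at h1
    have h2 : ε * weightedEnergy (D.indicator fun _ => 1) u ≤ 0 := by
      have := nonpos_of_mul_nonpos_right h1 hδ
      linarith [weightedEnergy_nonneg hρw u]
    have h3 : weightedEnergy (D.indicator fun _ => 1) u ≤ 0 := nonpos_of_mul_nonpos_right h2 hε
    have h4 := hP ρ hρ u hut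
    rw [h0, add_zero] at h4
    have h5 := h4.trans (mul_nonpos_of_nonneg_of_nonpos hC h3)
    have h6 := hS.weightedMass_pos hD hw₂ hu hu0
    rw [weightedMass_indicator_add_const hDo hD hρ _ hut, h0, zero_add] at h6
    exact h6.not_ge (mul_nonpos_of_nonneg_of_nonpos (by positivity) h5)
  · intro u hu _
    rw [div_mul_eq_mul_div, le_div_iff₀ hδ, mul_comm]
    refine le_trans ?_ (key u hu)
    gcongr
    linarith [mul_nonneg hε.le (weightedEnergy_nonneg h1D u)]

end Regularization

/-! ### Existence of maximizers and convergence of the maxima -/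

section Maximization

variable {N : ℕ} {D : Set (EuclideanSpace ℝ (Fin N))} {m : ℝ}

lemma densitiesOfMass_nonempty (hDo : IsOpen D) (hD : Bornology.IsBounded D) (hm : 0 < m)
    (hmD : ENNReal.ofReal m ≤ volume D) : (densitiesOfMass D m).Nonempty := by
  have hvol : volume D ≠ ⊤ := hD.measure_lt_top.ne
  have hle : m ≤ (volume D).toReal := (ENNReal.ofReal_le_iff_le_toReal hvol).1 hmD
  have hpos : 0 < (volume D).toReal := hm.trans_le hle
  refine ⟨D.indicator fun _ => m / (volume D).toReal,
    measurable_const.indicator hDo.measurableSet, fun x => ⟨?_, ?_⟩,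
    fun x hx => indicator_of_notMem hx _, ?_⟩
  · exact indicator_nonneg (fun _ _ => by positivity) x
  · exact indicator_apply_le' (fun _ => (div_le_one hpos).2 hle) fun _ => zero_le_one
  · rw [setIntegral_indicator hDo.measurableSet, inter_self, setIntegral_const, smul_eq_mul,
      measureReal_def]
    field_simp

lemma densityEigenvalue_lt_top (hN : 1 ≤ N) (hD : Bornology.IsBounded D) (hm : 0 < m)
    {ρ : EuclideanSpace ℝ (Fin N) → ℝ} (hρ : ρ ∈ densitiesOfMass D m) (k : ℕ) :
    densityEigenvalue k ρ < ⊤ := by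
  have hw := isWeight_of_mem_densitiesOfMass hρ
  refine pairEigenvalue_lt_top hN hD hw hw (fun h0 => hm.ne' ?_) k
  rw [← hρ.2.2.2]
  refine integral_eq_zero_of_ae (ae_restrict_of_ae ?_)
  filter_upwards [measure_eq_zero_iff_ae_notMem.1 h0] with x hx
  exact le_antisymm (not_lt.1 hx) (hw.nonneg x)

lemma regularizedEigenvalue_lt_top (hN : 1 ≤ N) (hDo : IsOpen D) (hD : Bornology.IsBounded D)
    (hne : D.Nonempty) {ρ : EuclideanSpace ℝ (Fin N) → ℝ} (hρ : ρ ∈ densitiesOfMass D m) (k : ℕ)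
    {ε : ℝ} (hε : 0 < ε) : regularizedEigenvalue D k ε ρ < ⊤ := by
  refine pairEigenvalue_lt_top hN hD (isWeight_indicator_add_const hDo hρ hε.le)
    (isWeight_indicator_add_const hDo hρ (sq_nonneg ε)) (fun h0 => ?_) k
  refine (hDo.measure_pos volume hne).ne' (measure_mono_null (fun x hx => ?_) h0)
  have : 0 < ρ x + ε ^ 2 := add_pos_of_nonneg_of_pos (hρ.2.1 x).1 (by positivity)
  simpa [hx] using this

/-- The direct method: a finite functional of the density that is upper semicontinuous for weak-*
convergence attains its maximum. -/
lemma exists_isGreatest_image_densitiesOfMass (hDo : IsOpen D) (hD : Bornology.IsBounded D)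
    (hne : (densitiesOfMass D m).Nonempty) {F : (EuclideanSpace ℝ (Fin N) → ℝ) → ℝ≥0∞}
    (htop : ∀ ρ ∈ densitiesOfMass D m, F ρ < ⊤)
    (husc : ∀ (𝒰 : Ultrafilter ℕ) (ρ : ℕ → EuclideanSpace ℝ (Fin N) → ℝ),
      (∀ i, ρ i ∈ densitiesOfMass D m) → ∀ ρ₀ ∈ densitiesOfMass D m, WeightTendsto ρ 𝒰 ρ₀ →
        ∀ c : ℝ≥0, F ρ₀ < c → ∀ᶠ i in (𝒰 : Filter ℕ), F (ρ i) ≤ c) :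
    ∃ M : ℝ≥0, IsGreatest (F '' densitiesOfMass D m) (M : ℝ≥0∞) := by
  obtain ⟨s, -, hs, hsm⟩ := exists_seq_tendsto_sSup (hne.image F) (OrderTop.bddAbove _)
  choose ρ hρ hρs using hsm
  obtain ⟨ρ₀, hρ₀, hlim⟩ :=
    exists_weightTendsto_of_mem_densitiesOfMass (hyperfilter ℕ) hDo hD hρ
  refine ⟨(F ρ₀).toNNReal, ?_⟩
  rw [ENNReal.coe_toNNReal (htop ρ₀ hρ₀).ne]
  refine ⟨mem_image_of_mem F hρ₀, fun y hy => (le_sSup hy).trans ?_⟩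
  by_contra! h
  obtain ⟨c, hc, hc'⟩ := ENNReal.lt_iff_exists_nnreal_btwn.1 h
  refine hc'.not_ge (le_of_tendsto (hs.mono_left Nat.hyperfilter_le_atTop) ?_)
  filter_upwards [husc _ ρ hρ ρ₀ hρ₀ hlim c hc] with i hi
  rwa [← hρs i]

end Maximization

theorem mainTheorem7 {N : ℕ} (hN : 1 ≤ N) (D : Set (EuclideanSpace ℝ (Fin N)))
    (hD_open : IsOpen D) (hD_bounded : Bornology.IsBounded D) (hD_connected : IsConnected D)
    (hD_lipschitz : HasLipschitzBoundary D)
    (m : ℝ) (hm : 0 < m) (hmD : ENNReal.ofReal m ≤ volume D) (k : ℕ) :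
    ∃ (M : ℝ≥0) (Mreg : ℝ → ℝ≥0),
      IsGreatest (densityEigenvalue k '' densitiesOfMass D m) (M : ℝ≥0∞) ∧
      (∀ ε : ℝ, 0 < ε →
        IsGreatest (regularizedEigenvalue D k ε '' densitiesOfMass D m) (Mreg ε : ℝ≥0∞)) ∧
      Tendsto Mreg (𝓝[>] 0) (𝓝 M) := by
  have hne := densitiesOfMass_nonempty hD_open hD_bounded hm hmD
  have hw {ρ} (hρ : ρ ∈ densitiesOfMass D m) := isWeight_of_mem_densitiesOfMass hρ
  obtain ⟨M, hM⟩ := exists_isGreatest_image_densitiesOfMass hD_open hD_bounded hne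
    (F := densityEigenvalue k) (fun ρ hρ => densityEigenvalue_lt_top hN hD_bounded hm hρ k)
    fun 𝒰 ρ hρ ρ₀ hρ₀ hlim c hc => eventually_pairEigenvalue_le hD_bounded (fun i => hw (hρ i))
      (fun i => hw (hρ i)) (hw hρ₀) (hw hρ₀) hlim hlim hc
  have hreg (ε : ℝ) : ∃ Mε : ℝ≥0, 0 < ε →
      IsGreatest (regularizedEigenvalue D k ε '' densitiesOfMass D m) (Mε : ℝ≥0∞) := by
    by_cases hε : 0 < ε
    · obtain ⟨Mε, h⟩ := exists_isGreatest_image_densitiesOfMass hD_open hD_bounded hne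
        (F := regularizedEigenvalue D k ε)
        (fun ρ hρ => regularizedEigenvalue_lt_top hN hD_open hD_bounded hD_connected.nonempty hρ k
          hε)
        fun 𝒰 ρ hρ ρ₀ hρ₀ hlim c hc => eventually_pairEigenvalue_le hD_bounded
          (fun i => isWeight_indicator_add_const hD_open (hρ i) hε.le)
          (fun i => isWeight_indicator_add_const hD_open (hρ i) (sq_nonneg ε))
          (isWeight_indicator_add_const hD_open hρ₀ hε.le)
          (isWeight_indicator_add_const hD_open hρ₀ (sq_nonneg ε))
          (hlim.indicator_add_const hD_open hD_bounded hρ hρ₀ tendsto_const_nhds)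
          (hlim.indicator_add_const hD_open hD_bounded hρ hρ₀ tendsto_const_nhds) hc
      exact ⟨Mε, fun _ => h⟩
    · exact ⟨0, fun h => absurd h hε⟩
  choose Mreg hMreg using hreg
  refine ⟨M, Mreg, hM, hMreg, tendsto_order.2 ⟨fun a ha => ?_, fun b hb => ?_⟩⟩
  · -- The bound at a maximizer `ρ` of `μ_k`, in the limit `ε → 0`, would give `M ≤ a`.
    obtain ⟨C, hC, hP⟩ := exists_weightedMass_indicator_one_le hD_open hD_bounded hD_connected
      hD_lipschitz hm
    obtain ⟨ρ, hρ, hρM⟩ := hM.1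
    obtain ⟨a', haa', ha'M⟩ := exists_between ha
    have h1 : Tendsto (fun ε : ℝ => a' * (1 + C * ε ^ 2) / (1 - a' * C * ε)) (𝓝 0)
        (𝓝 (a' : ℝ)) := by
      have : ContinuousAt (fun ε : ℝ => a' * (1 + C * ε ^ 2) / (1 - a' * C * ε)) 0 := by
        refine ContinuousAt.div (by fun_prop) (by fun_prop) (by simp)
      simpa using this.tendsto
    have h2 : Tendsto (fun ε : ℝ => a' * C * ε) (𝓝 0) (𝓝 0) := by
      have : Continuous fun ε : ℝ => a' * C * ε := by fun_prop
      simpa using this.tendsto 0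
    filter_upwards [self_mem_nhdsWithin,
      (h1.eventually (gt_mem_nhds (NNReal.coe_lt_coe.2 ha'M))).filter_mono nhdsWithin_le_nhds,
      (h2.eventually (gt_mem_nhds zero_lt_one)).filter_mono nhdsWithin_le_nhds] with ε hε hε1 hε2
    have hε : 0 < ε := hε
    by_contra! h
    have h3 : regularizedEigenvalue D k ε ρ < a' :=
      ((hMreg ε hε).2 (mem_image_of_mem _ hρ)).trans_lt (by exact_mod_cast h.trans_lt haa')
    have h4 :=
      densityEigenvalue_le_of_regularizedEigenvalue_lt hD_open hD_bounded hC hP hρ hε h3 hε2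
    rw [hρM, ← ENNReal.ofReal_coe_nnreal] at h4
    have hM0 : (0 : ℝ) < M := lt_of_le_of_lt a'.2 (NNReal.coe_lt_coe.2 ha'M)
    exact h4.not_gt ((ENNReal.ofReal_lt_ofReal_iff hM0).2 hε1)
  · -- Otherwise maximizers `ρ ε` of the regularized problems with values at least `b` would have a
    -- weak-* limit point `ρ₀` with `μ_k ρ₀ ≤ M < b`, against upper semicontinuity.
    by_contra hcon
    obtain ⟨b', hMb', hb'b⟩ := exists_between hb
    let l : Filter ℝ := 𝓝[>] 0 ⊓ 𝓟 {ε | ¬ Mreg ε < b}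
    have : l.NeBot := frequently_iff_neBot.1 (not_eventually.1 hcon)
    let 𝒰 : Ultrafilter ℝ := Ultrafilter.of l
    have h𝒰 : (𝒰 : Filter ℝ) ≤ 𝓝[>] 0 := (Ultrafilter.of_le l).trans inf_le_left
    have h𝒰b : ∀ᶠ ε in (𝒰 : Filter ℝ), ¬ Mreg ε < b :=
      (Ultrafilter.of_le l).trans inf_le_right (mem_principal_self _)
    have hmax (ε : ℝ) : ∃ ρ ∈ densitiesOfMass D m, 0 < ε →
        regularizedEigenvalue D k ε ρ = Mreg ε := by
      by_cases hε : 0 < ε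
      · obtain ⟨ρ, hρ, h⟩ := (hMreg ε hε).1
        exact ⟨ρ, hρ, fun _ => h⟩
      · obtain ⟨ρ, hρ⟩ := hne
        exact ⟨ρ, hρ, fun h => absurd h hε⟩
    choose ρ hρ hρM using hmax
    obtain ⟨ρ₀, hρ₀, hlim⟩ :=
      exists_weightTendsto_of_mem_densitiesOfMass 𝒰 hD_open hD_bounded hρ
    have h0 : Tendsto (fun ε : ℝ => |ε|) 𝒰 (𝓝 0) := by
      have h1 : Tendsto (fun ε : ℝ => |ε|) (𝓝 0) (𝓝 |0|) := continuous_abs.tendsto 0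
      rw [abs_zero] at h1
      exact h1.mono_left (h𝒰.trans nhdsWithin_le_nhds)
    have h0' : Tendsto (fun ε : ℝ => ε ^ 2) 𝒰 (𝓝 0) := by
      have h1 : Tendsto (fun ε : ℝ => ε ^ 2) (𝓝 0) (𝓝 (0 ^ 2)) := (continuous_pow 2).tendsto 0
      rw [zero_pow two_ne_zero] at h1
      exact h1.mono_left (h𝒰.trans nhdsWithin_le_nhds)
    have hz : (D.indicator fun x => ρ₀ x + 0) = ρ₀ := by
      ext x
      by_cases hx : x ∈ D
      · simp [hx]
      · simp [hx, hρ₀.2.2.1 x hx]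
    have ht₁ := hlim.indicator_add_const hD_open hD_bounded hρ hρ₀ h0
    have ht₂ := hlim.indicator_add_const hD_open hD_bounded hρ hρ₀ h0'
    rw [hz] at ht₁ ht₂
    have hlt : pairEigenvalue k ρ₀ ρ₀ < b' :=
      (hM.2 (mem_image_of_mem (densityEigenvalue k) hρ₀)).trans_lt (by exact_mod_cast hMb')
    -- The energy weights use `|ε|`, so that they are weights for every index `ε`.
    have hev := eventually_pairEigenvalue_le hD_bounded
      (fun ε => isWeight_indicator_add_const hD_open (hρ ε) (abs_nonneg ε))
      (fun ε => isWeight_indicator_add_const hD_open (hρ ε) (sq_nonneg ε))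
      (hw hρ₀) (hw hρ₀) ht₁ ht₂ hlt
    obtain ⟨ε, hε1, hε2, hε⟩ := (hev.and (h𝒰b.and (h𝒰 self_mem_nhdsWithin))).exists
    have hε : 0 < ε := hε
    rw [abs_of_pos hε] at hε1
    have h3 := hρM ε hε
    rw [regularizedEigenvalue] at h3
    rw [h3] at hε1
    exact hε2 ((ENNReal.coe_le_coe.1 hε1).trans_lt hb'b)
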